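/- Let $X$ be a compact metric space with metric $d$ and finite Hausdorff dimension $w$, let $Y$ be a compact Hausdorff space, and let $\mu,\nu$ be $\sigma$-finite regular Borel measures on $X$ and $Y$ (regular: measurable sets of finite measure are inner regular with respect to compact sets). A set $M\subset X\times Y$ is marginally null if $M\subset (X_1\times Y)\cup(X\times Y_1)$ with $\mu(X_1)=\nu(Y_1)=0$; "m.a.e." means outside a marginally null set. A set is pseudo-closed if its complement differs by a marginally null set from a countable union of rectangles $A\times B$ with $A\subset X$, $B\subset Y$ measurable. For a pseudo-closed set $E$ let $\mathfrak M_{max}(E)$ be the set of bounded operators $T:L_2(X,\mu)\to L_2(Y,\nu)$ supported in $E$, i.e. such that $M_{\chi_V}TM_{\chi_U}=0$ for all measurable $U\subset X$, $V\subset Y$ for which $(U\times V)\cap E$ is marginally null; here $M_f$ denotes multiplication by $f$. $V_\infty(X,Y)$ is the space of functions $F$ on $X\times Y$, identified when equal m.a.e., that can be written $F(x,y)=\sum_{n} f_n(x)g_n(y)$ m.a.e. with $f_n\in L^\infty(X,\mu)$, $g_n\in L^\infty(Y,\nu)$, $\sum_n\|f_n\|_\infty^2<\infty$, $\sum_n\|g_n\|_\infty^2<\infty$.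 For such an $F$, given by any such series, put $\Delta_F(T)=F\cdot T=\sum_n M_{g_n}TM_{f_n}$ (norm convergent) for $T\in B(L_2(X,\mu),L_2(Y,\nu))$. $F$ vanishes on a set if it is $0$ at m.a.e. point of it, and $\operatorname{null}F$ is the largest (up to marginally null sets) pseudo-closed set on which $F$ vanishes. $F$ is operator synthetic if $\ker\Delta_F=\mathfrak M_{max}(\operatorname{null}F)$. Theorem. Let $E\subset X\times Y$ be pseudo-closed, put $E^y=\{x\in X:(x,y)\in E\}$, let $\rho>0$ with $\rho\ge w/2$, and, in the case of equality $\rho=w/2$, assume that $X$ is $\sigma$-finite for the $w$-dimensional Hausdorff measure $\mathcal H^w$ (for instance $\mathcal H^w(X)<\infty$). Let $F\in V_\infty(X,Y)$ satisfy, for some constant $C>0$, $$|F(x,y)|\le C\,d(x,E^y)^{\rho}\quad\text{for m.a.e. }(x,y)\in X\times Y,$$ where $d(x,\emptyset)=\infty$. Then $\mathfrak M_{max}(E)\subset\ker\Delta_F$. In particular, if $E=\operatorname{null}F$, then $F$ is operator synthetic. -/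

import Mathlib

open MeasureTheory
open scoped ENNReal NNReal

noncomputable section

namespace OpSynth

variable {X Y : Type*} [MeasurableSpace X] [MeasurableSpace Y]

/-- A subset of `X × Y` is marginally null if it is contained in
`(X₁ × Y) ∪ (X × Y₁)` with `μ X₁ = 0` and `ν Y₁ = 0`. -/
def MarginallyNull (μ : Measure X) (ν : Measure Y) (M : Set (X × Y)) : Prop :=
  ∃ (X₁ : Set X) (Y₁ : Set Y), μ X₁ = 0 ∧ ν Y₁ = 0 ∧
    M ⊆ (X₁ ×ˢ Set.univ) ∪ (Set.univ ×ˢ Y₁)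

/-- `p x y` holds marginally almost everywhere. -/
def MarginallyAE (μ : Measure X) (ν : Measure Y) (p : X → Y → Prop) : Prop :=
  MarginallyNull μ ν {z | ¬ p z.1 z.2}

/-- Pseudo-open sets: countable unions of measurable rectangles, modulo marginally null sets. -/
def PseudoOpen (μ : Measure X) (ν : Measure Y) (M : Set (X × Y)) : Prop :=
  ∃ (A : ℕ → Set X) (B : ℕ → Set Y),
    (∀ n, MeasurableSet (A n)) ∧ (∀ n, MeasurableSet (B n)) ∧
    MarginallyNull μ ν (symmDiff M (⋃ n, A n ×ˢ B n))

/-- Pseudo-closed sets: complements of pseudo-open sets. -/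
def PseudoClosed (μ : Measure X) (ν : Measure Y) (E : Set (X × Y)) : Prop :=
  PseudoOpen μ ν Eᶜ

/-- The operator of multiplication by an `L^∞` function on `L²`. -/
def mulOp (μ : Measure X) (f : Lp ℂ ∞ μ) : Lp ℂ 2 μ →L[ℂ] Lp ℂ 2 μ :=
  (ContinuousLinearMap.mul ℂ ℂ).holderL μ ∞ 2 2 f

lemma norm_mulOp_le (μ : Measure X) (f : Lp ℂ ∞ μ) : ‖mulOp μ f‖ ≤ ‖f‖ := by
  refine (ContinuousLinearMap.le_opNorm _ f).trans ?_
  refine mul_le_of_le_one_left (norm_nonneg f) ?_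
  exact ((ContinuousLinearMap.mul ℂ ℂ).norm_holderL_le).trans
    (ContinuousLinearMap.opNorm_mul_le ℂ ℂ)

/-- The operator of multiplication by the characteristic function of a measurable set. -/
def indicatorOp (μ : Measure X) (U : Set X) (hU : MeasurableSet U) :
    Lp ℂ 2 μ →L[ℂ] Lp ℂ 2 μ :=
  mulOp μ (((memLp_top_const (1 : ℂ)).indicator hU).toLp (U.indicator fun _ => (1 : ℂ)))

/-- The operator `T : L²(X, μ) → L²(Y, ν)` is supported in `E`: `Q(V) T P(U) = 0` for all
measurable `U`, `V` such that `(U × V) ∩ E` is marginally null. -/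
def SupportedIn {μ : Measure X} {ν : Measure Y} (T : Lp ℂ 2 μ →L[ℂ] Lp ℂ 2 ν)
    (E : Set (X × Y)) : Prop :=
  ∀ (U : Set X) (V : Set Y) (hU : MeasurableSet U) (hV : MeasurableSet V),
    MarginallyNull μ ν ((U ×ˢ V) ∩ E) →
      indicatorOp ν V hV ∘L T ∘L indicatorOp μ U hU = 0

/-- The set of all bounded operators supported in `E`. -/
def Mmax (μ : Measure X) (ν : Measure Y) (E : Set (X × Y)) :
    Set (Lp ℂ 2 μ →L[ℂ] Lp ℂ 2 ν) :=
  {T | SupportedIn T E}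

/-- A series `∑ fₙ ⊗ gₙ` with `fₙ ∈ L^∞(X, μ)`, `gₙ ∈ L^∞(Y, ν)`, `∑ ‖fₙ‖² < ∞` and
`∑ ‖gₙ‖² < ∞`. -/
structure VInftyRep (μ : Measure X) (ν : Measure Y) where
  f : ℕ → Lp ℂ ∞ μ
  g : ℕ → Lp ℂ ∞ ν
  summable_f : Summable fun n => ‖f n‖ ^ 2
  summable_g : Summable fun n => ‖g n‖ ^ 2

/-- The series represents the function `F`, that is, `F(x, y) = ∑ fₙ(x) gₙ(y)` marginally
almost everywhere. The space `V_∞(X, Y)` consists of the functions that have such a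
representation, identified when they agree marginally almost everywhere. -/
def VInftyRep.Represents {μ : Measure X} {ν : Measure Y} (R : VInftyRep μ ν)
    (F : X → Y → ℂ) : Prop :=
  MarginallyAE μ ν fun x y => HasSum (fun n => R.f n x * R.g n y) (F x y)

variable {μ : Measure X} {ν : Measure Y}

lemma VInftyRep.summable_action (R : VInftyRep μ ν) (T : Lp ℂ 2 μ →L[ℂ] Lp ℂ 2 ν) :
    Summable fun n => mulOp ν (R.g n) ∘L T ∘L mulOp μ (R.f n) := by
  refine Summable.of_norm_bounded
    (g := fun n => ‖T‖ * (‖R.f n‖ ^ 2 + ‖R.g n‖ ^ 2))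
    ((R.summable_f.add R.summable_g).mul_left _) fun n => ?_
  have h1 : ‖mulOp ν (R.g n) ∘L T ∘L mulOp μ (R.f n)‖ ≤ ‖R.g n‖ * (‖T‖ * ‖R.f n‖) := by
    refine (ContinuousLinearMap.opNorm_comp_le _ _).trans ?_
    refine mul_le_mul (norm_mulOp_le _ _) ?_ (norm_nonneg _) (norm_nonneg _)
    refine (ContinuousLinearMap.opNorm_comp_le _ _).trans ?_
    exact mul_le_mul_of_nonneg_left (norm_mulOp_le _ _) (norm_nonneg _)
  have h2 : ‖R.g n‖ * ‖R.f n‖ ≤ ‖R.f n‖ ^ 2 + ‖R.g n‖ ^ 2 := by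
    nlinarith [sq_nonneg (‖R.f n‖ - ‖R.g n‖), sq_nonneg (‖R.f n‖), sq_nonneg (‖R.g n‖)]
  calc _ ≤ ‖R.g n‖ * (‖T‖ * ‖R.f n‖) := h1
    _ = ‖T‖ * (‖R.g n‖ * ‖R.f n‖) := by ring
    _ ≤ _ := mul_le_mul_of_nonneg_left h2 (norm_nonneg _)

/-- The map `Δ_F : T ↦ F · T = ∑ M_{gₙ} T M_{fₙ}`; the series converges in the operator norm. -/
def VInftyRep.Delta (R : VInftyRep μ ν) :
    (Lp ℂ 2 μ →L[ℂ] Lp ℂ 2 ν) →ₗ[ℂ] (Lp ℂ 2 μ →L[ℂ] Lp ℂ 2 ν) where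
  toFun T := ∑' n, mulOp ν (R.g n) ∘L T ∘L mulOp μ (R.f n)
  map_add' S T := by
    rw [← (R.summable_action S).tsum_add (R.summable_action T)]
    simp [ContinuousLinearMap.add_comp, ContinuousLinearMap.comp_add]
  map_smul' c T := by
    rw [RingHom.id_apply, ← (R.summable_action T).tsum_const_smul c]
    simp [ContinuousLinearMap.smul_comp]

/-- `F` vanishes on `E`, that is, `F χ_E = 0` marginally almost everywhere. -/
def VanishesOn (μ : Measure X) (ν : Measure Y) (F : X → Y → ℂ) (E : Set (X × Y)) : Prop :=
  MarginallyAE μ ν fun x y => (x, y) ∈ E → F x y = 0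

/-- `E = null F`: `E` is the largest, up to marginally null sets, pseudo-closed set on which
`F` vanishes. -/
def IsNullSet (μ : Measure X) (ν : Measure Y) (F : X → Y → ℂ) (E : Set (X × Y)) : Prop :=
  PseudoClosed μ ν E ∧ VanishesOn μ ν F E ∧
    ∀ E' : Set (X × Y), PseudoClosed μ ν E' → VanishesOn μ ν F E' → MarginallyNull μ ν (E' \ E)

/-- The element `F` of `V_∞(X, Y)`, represented by the series `R`, is operator synthetic:
`ker Δ_F = 𝔐_max(null F)`. -/
def IsOperatorSynthetic (F : X → Y → ℂ) (R : VInftyRep μ ν) : Prop :=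
  ∃ N : Set (X × Y), IsNullSet μ ν F N ∧
    (LinearMap.ker R.Delta : Set (Lp ℂ 2 μ →L[ℂ] Lp ℂ 2 ν)) = Mmax μ ν N

end OpSynth

end

/-!
The theorem is of Beurling–Pollard type: an operator `T` supported in `E` is approximated by
operators with square integrable kernels living close to `E`, where `F` is small.

Modulo a marginally null set, the complement of `E` is exactly a countable union of measurable
rectangles `A n × B n`, and `T` vanishes on each of them. By inner regularity of `μ`, almost all
of `X` is exhausted by compact sets `G` in which every `A n` is relatively open and which have
finite `2ρ`-dimensional Hausdorff measure (this measure is `σ`-finite: for `2ρ > w` it is zero).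
For such a `G`, let `P` be the averaging operator of a finite partition of `G` into pieces `D j`,
with normalised indicator functions `e j`. Then `T P = ∑ T (e j) ⊗ e j`, and by compactness
`T (e j)` is supported in the set of those `y` for which the closure of `D j` meets `E^y`.
There `|F| ≤ C (diam D j)^ρ` on `D j`, so the `L²` norm of the kernel of `Δ_F(T P)` is at
most `C ‖T‖ (∑ (diam D j)^{2ρ})^{1/2}`, and for suitable partitions the sum is at most the
Hausdorff measure of `G` plus one (`VInftyRep.Represents.exists_averaging`). Since `F = 0` on `E`, this kernel vanishes
on `E`. As the mesh tends to `0`, `P` tends to `P(G)` strongly, hence the kernel of `Δ_F(T P(G))`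
is square integrable and vanishes on `E`. It also vanishes on the rectangles `A n × B n`, because
`T` does. Therefore `Δ_F(T P(G)) = 0`, also in the limiting case `2ρ = w`, where the bounds do not
tend to `0`. The square integrable limit kernel is never constructed: the bound is stated for
finite sums of elementary tensors, and the rectangles are cut out of an elementary tensor one
after the other (`eq_zero_of_vanishesOnRect_of_bound`).

For the converse inclusion in the definition of operator synthesis, let `Δ_F(T) = 0`. Near a point
with `F(x, y) ≠ 0`, on a rectangle where all `f m` and `g m` are almost constant, `Δ_F` is a small
perturbation of a nonzero multiple of the identity, so `T` vanishes on that rectangle. Countably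
many such rectangles make up the set where `F ≠ 0` (`VInftyRep.exists_rectangles`), and an
operator vanishing on countably many rectangles that cover `X × Y` is zero
(`eq_zero_of_vanishesOnRect_of_cover`).
-/

namespace OpSynth

/-! ### Operators on `L²` spaces and rectangles -/

section Basic

variable {X Y : Type*} [MeasurableSpace X] [MeasurableSpace Y] {μ : Measure X} {ν : Measure Y}

lemma MarginallyNull.mono {M N : Set (X × Y)} (hN : MarginallyNull μ ν N) (h : M ⊆ N) :
    MarginallyNull μ ν M := by
  obtain ⟨X₁, Y₁, hX, hY, hsub⟩ := hN
  exact ⟨X₁, Y₁, hX, hY, h.trans hsub⟩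

lemma MarginallyNull.union {M N : Set (X × Y)} (hM : MarginallyNull μ ν M)
    (hN : MarginallyNull μ ν N) : MarginallyNull μ ν (M ∪ N) := by
  obtain ⟨X₁, Y₁, hX₁, hY₁, h₁⟩ := hM
  obtain ⟨X₂, Y₂, hX₂, hY₂, h₂⟩ := hN
  refine ⟨X₁ ∪ X₂, Y₁ ∪ Y₂, measure_union_null hX₁ hX₂, measure_union_null hY₁ hY₂, ?_⟩
  rintro z (hz | hz)
  · rcases h₁ hz with h | h
    · exact Or.inl ⟨Or.inl h.1, h.2⟩
    · exact Or.inr ⟨h.1, Or.inl h.2⟩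
  · rcases h₂ hz with h | h
    · exact Or.inl ⟨Or.inr h.1, h.2⟩
    · exact Or.inr ⟨h.1, Or.inr h.2⟩

lemma MarginallyNull.prod_eq_zero [SFinite ν] {M : Set (X × Y)} (hM : MarginallyNull μ ν M) :
    (μ.prod ν) M = 0 := by
  obtain ⟨X₁, Y₁, hX, hY, h⟩ := hM
  refine measure_mono_null h (measure_union_null ?_ ?_)
  · rw [Measure.prod_prod, hX, zero_mul]
  · rw [Measure.prod_prod, hY, mul_zero]

lemma MarginallyAE.ae [SFinite ν] {p : X → Y → Prop} (h : MarginallyAE μ ν p) :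
    ∀ᵐ z ∂μ.prod ν, p z.1 z.2 :=
  h.prod_eq_zero

lemma mulOp_apply_ae (f : Lp ℂ ∞ μ) (ξ : Lp ℂ 2 μ) :
    mulOp μ f ξ =ᵐ[μ] fun x => f x * ξ x :=
  ContinuousLinearMap.coeFn_holder (ContinuousLinearMap.mul ℂ ℂ) f ξ

lemma indicatorOp_apply_ae {U : Set X} (hU : MeasurableSet U) (ξ : Lp ℂ 2 μ) :
    indicatorOp μ U hU ξ =ᵐ[μ] U.indicator ξ := by
  refine (mulOp_apply_ae _ ξ).trans ?_
  filter_upwards [((memLp_top_const (1 : ℂ)).indicator hU : MemLp _ ∞ μ).coeFn_toLp] with x hx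
  rw [hx]
  by_cases h : x ∈ U <;> simp [h]

lemma indicatorOp_apply_eq_self {U : Set X} (hU : MeasurableSet U) {ξ : Lp ℂ 2 μ}
    (hξ : ∀ᵐ x ∂μ, x ∉ U → ξ x = 0) : indicatorOp μ U hU ξ = ξ := by
  refine Lp.ext ((indicatorOp_apply_ae hU ξ).trans ?_)
  filter_upwards [hξ] with x hx
  by_cases h : x ∈ U <;> simp [h, hx]

lemma indicatorOp_apply_eq_zero_of_notMem {U : Set X} (hU : MeasurableSet U) (ξ : Lp ℂ 2 μ) :
    ∀ᵐ x ∂μ, x ∉ U → indicatorOp μ U hU ξ x = 0 := by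
  filter_upwards [indicatorOp_apply_ae hU ξ] with x hx h
  simp [hx, h]

lemma indicatorOp_apply_eq_zero_iff {U : Set X} (hU : MeasurableSet U) {ξ : Lp ℂ 2 μ} :
    indicatorOp μ U hU ξ = 0 ↔ ∀ᵐ x ∂μ, x ∈ U → ξ x = 0 := by
  constructor
  · intro h
    have h0 : indicatorOp μ U hU ξ =ᵐ[μ] 0 := by rw [h]; exact Lp.coeFn_zero _ _ _
    filter_upwards [h0, indicatorOp_apply_ae hU ξ] with x h1 h2 hx
    simpa [h2, hx] using h1
  · intro h
    refine Lp.ext (((indicatorOp_apply_ae hU ξ).trans ?_).trans (Lp.coeFn_zero _ _ _).symm)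
    filter_upwards [h] with x hx
    by_cases hxU : x ∈ U <;> simp [hxU, hx]

lemma mulOp_comp_indicatorOp (f : Lp ℂ ∞ μ) {U : Set X} (hU : MeasurableSet U) :
    mulOp μ f ∘L indicatorOp μ U hU = indicatorOp μ U hU ∘L mulOp μ f := by
  ext1 ξ
  refine Lp.ext ?_
  filter_upwards [mulOp_apply_ae f (indicatorOp μ U hU ξ), indicatorOp_apply_ae hU ξ,
    indicatorOp_apply_ae hU (mulOp μ f ξ), mulOp_apply_ae f ξ] with x h1 h2 h3 h4
  simp only [ContinuousLinearMap.comp_apply]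
  rw [h1, h2, h3]
  by_cases h : x ∈ U <;> simp [h, h4]

/-- The operator `T` vanishes on the rectangle `U × V`: it maps functions supported in `U` to
functions that vanish on `V`. For measurable `U` and `V` this says that `Q(V) T P(U) = 0`. -/
def VanishesOnRect (T : Lp ℂ 2 μ →L[ℂ] Lp ℂ 2 ν) (U : Set X) (V : Set Y) : Prop :=
  ∀ ξ : Lp ℂ 2 μ, (∀ᵐ x ∂μ, x ∉ U → ξ x = 0) → ∀ᵐ y ∂ν, y ∈ V → T ξ y = 0

lemma vanishesOnRect_iff {T : Lp ℂ 2 μ →L[ℂ] Lp ℂ 2 ν} {U : Set X} {V : Set Y}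
    (hU : MeasurableSet U) (hV : MeasurableSet V) :
    VanishesOnRect T U V ↔ indicatorOp ν V hV ∘L T ∘L indicatorOp μ U hU = 0 := by
  constructor
  · intro h
    ext1 ξ
    exact (indicatorOp_apply_eq_zero_iff hV).2
      (h _ (indicatorOp_apply_eq_zero_of_notMem hU ξ))
  · intro h ξ hξ
    have := congrArg (fun S => S ξ) h
    simp only [ContinuousLinearMap.comp_apply, zero_apply,
      indicatorOp_apply_eq_self hU hξ] at this
    exact (indicatorOp_apply_eq_zero_iff hV).1 this

lemma VanishesOnRect.mono {T : Lp ℂ 2 μ →L[ℂ] Lp ℂ 2 ν} {U U' : Set X} {V V' : Set Y}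
    (h : VanishesOnRect T U V) (hU : U' ⊆ U) (hV : V' ⊆ V) : VanishesOnRect T U' V' := by
  intro ξ hξ
  filter_upwards [h ξ (hξ.mono fun x hx hxU => hx fun h' => hxU (hU h'))] with y hy hyV
  exact hy (hV hyV)

lemma VanishesOnRect.of_measure_eq_zero_left (T : Lp ℂ 2 μ →L[ℂ] Lp ℂ 2 ν) {U : Set X}
    (V : Set Y) (hU : μ U = 0) : VanishesOnRect T U V := by
  intro ξ hξ
  have h0 : ξ = 0 := by
    refine Lp.ext (Filter.EventuallyEq.trans ?_ (Lp.coeFn_zero _ _ _).symm)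
    filter_upwards [hξ, measure_eq_zero_iff_ae_notMem.1 hU] with x h1 h2
    exact h1 h2
  rw [h0, map_zero]
  filter_upwards [Lp.coeFn_zero ℂ 2 ν] with y hy _
  simpa using hy

lemma VanishesOnRect.iUnion_right {ι : Type*} [Countable ι] {T : Lp ℂ 2 μ →L[ℂ] Lp ℂ 2 ν}
    {U : Set X} {V : ι → Set Y} (h : ∀ i, VanishesOnRect T U (V i)) :
    VanishesOnRect T U (⋃ i, V i) := by
  intro ξ hξ
  filter_upwards [ae_all_iff.2 fun i => h i ξ hξ] with y hy hyV
  obtain ⟨i, hi⟩ := Set.mem_iUnion.1 hyV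
  exact hy i hi

/-- The summand living on `U` is split off by `P(U)`, which is why `U` has to be measurable. -/
lemma VanishesOnRect.union_left {T : Lp ℂ 2 μ →L[ℂ] Lp ℂ 2 ν} {U U' : Set X} {V : Set Y}
    (hUm : MeasurableSet U) (h : VanishesOnRect T U V) (h' : VanishesOnRect T U' V) :
    VanishesOnRect T (U ∪ U') V := by
  intro ξ hξ
  have hsub : ∀ᵐ x ∂μ, x ∉ U' → (ξ - indicatorOp μ U hUm ξ) x = 0 := by
    filter_upwards [hξ, Lp.coeFn_sub ξ (indicatorOp μ U hUm ξ), indicatorOp_apply_ae hUm ξ]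
      with x h1 h2 h3 hx
    rw [h2, Pi.sub_apply, h3]
    by_cases hxU : x ∈ U
    · simp [hxU]
    · simp [hxU, h1 (by simp [hxU, hx])]
  filter_upwards [h _ (indicatorOp_apply_eq_zero_of_notMem hUm ξ), h' _ hsub,
    Lp.coeFn_sub (T ξ) (T (indicatorOp μ U hUm ξ))] with y h1 h2 h3 hy
  have h4 := h2 hy
  rw [map_sub, h3, Pi.sub_apply, h1 hy, sub_zero] at h4
  exact h4

lemma VanishesOnRect.biUnion_left {ι : Type*} {T : Lp ℂ 2 μ →L[ℂ] Lp ℂ 2 ν} {U : ι → Set X}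
    {V : Set Y} (hU : ∀ i, MeasurableSet (U i)) (S : Finset ι)
    (h : ∀ i ∈ S, VanishesOnRect T (U i) V) : VanishesOnRect T (⋃ i ∈ S, U i) V := by
  classical
  induction S using Finset.induction_on with
  | empty => simpa using VanishesOnRect.of_measure_eq_zero_left T V (measure_empty (μ := μ))
  | insert i S _ ih =>
    rw [Finset.set_biUnion_insert]
    exact (h i (by simp)).union_left (hU i) (ih fun j hj => h j (by simp [hj]))

/-- If almost every point lies in all but finitely many of the sets `K i`, then the
projections `P(K i)` converge strongly to the identity. -/
lemma tendsto_indicatorOp {K : ℕ → Set X} (hK : ∀ i, MeasurableSet (K i))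
    (h : ∀ᵐ x ∂μ, ∀ᶠ i in Filter.atTop, x ∈ K i) (ξ : Lp ℂ 2 μ) :
    Filter.Tendsto (fun i => indicatorOp μ (K i) (hK i) ξ) Filter.atTop (nhds ξ) := by
  rw [Lp.tendsto_Lp_iff_tendsto_eLpNorm']
  have hsq : ∫⁻ x, ‖ξ x‖ₑ ^ (2 : ℝ) ∂μ ≠ ∞ := by
    have := (eLpNorm_lt_top_iff_lintegral_rpow_enorm_lt_top two_ne_zero
      ENNReal.ofNat_ne_top).1 (Lp.memLp ξ).2
    simpa using this.ne
  have key : Filter.Tendsto (fun i => ∫⁻ x, ‖(K i)ᶜ.indicator ξ x‖ₑ ^ (2 : ℝ) ∂μ) Filter.atTop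
      (nhds (∫⁻ _, 0 ∂μ)) := by
    refine tendsto_lintegral_of_dominated_convergence' (fun x => ‖ξ x‖ₑ ^ (2 : ℝ))
      (fun i => ?_) (fun i => ?_) hsq ?_
    · exact (((Lp.aestronglyMeasurable ξ).indicator (hK i).compl).enorm).pow_const _
    · refine .of_forall fun x => ENNReal.rpow_le_rpow ?_ zero_le_two
      by_cases hx : x ∈ K i <;> simp [hx]
    · filter_upwards [h] with x hx
      refine tendsto_const_nhds.congr' ?_
      filter_upwards [hx] with i hi
      simp [hi]
  simp only [lintegral_zero] at key
  have key2 := key.ennrpow_const (1 / 2)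
  simp only [one_div, ENNReal.zero_rpow_of_pos (show (0 : ℝ) < 2⁻¹ by norm_num)] at key2
  refine key2.congr fun i => ?_
  rw [eLpNorm_eq_lintegral_rpow_enorm_toReal two_ne_zero ENNReal.ofNat_ne_top]
  simp only [ENNReal.toReal_ofNat, one_div]
  congr 1
  refine lintegral_congr_ae ?_
  filter_upwards [indicatorOp_apply_ae (hK i) ξ] with x hx
  rw [Pi.sub_apply, hx]
  by_cases hxK : x ∈ K i <;> simp [hxK]

lemma VInftyRep.hasSum_Delta_apply (R : VInftyRep μ ν) (T : Lp ℂ 2 μ →L[ℂ] Lp ℂ 2 ν)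
    (ξ : Lp ℂ 2 μ) :
    HasSum (fun n => mulOp ν (R.g n) (T (mulOp μ (R.f n) ξ))) (R.Delta T ξ) :=
  (R.summable_action T).hasSum.mapL (ContinuousLinearMap.apply ℂ (Lp ℂ 2 ν) ξ)

lemma VInftyRep.summable_norm_mul (R : VInftyRep μ ν) :
    Summable fun n => ‖R.f n‖ * ‖R.g n‖ := by
  refine Summable.of_nonneg_of_le (fun n => by positivity) (fun n => ?_)
    (R.summable_f.add R.summable_g)
  nlinarith [sq_nonneg (‖R.f n‖ - ‖R.g n‖), sq_nonneg (‖R.f n‖), sq_nonneg (‖R.g n‖)]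

/-- For a fixed vector, `Δ_F` is continuous along bounded strongly convergent sequences. -/
lemma VInftyRep.tendsto_Delta_comp (R : VInftyRep μ ν) (T : Lp ℂ 2 μ →L[ℂ] Lp ℂ 2 ν)
    {P : ℕ → Lp ℂ 2 μ →L[ℂ] Lp ℂ 2 μ} {Q : Lp ℂ 2 μ →L[ℂ] Lp ℂ 2 μ}
    (hP : ∀ n a, ‖P n a‖ ≤ ‖a‖)
    (hlim : ∀ a, Filter.Tendsto (fun n => P n a) Filter.atTop (nhds (Q a))) (ξ : Lp ℂ 2 μ) :
    Filter.Tendsto (fun n => R.Delta (T ∘L P n) ξ) Filter.atTop (nhds (R.Delta (T ∘L Q) ξ)) := by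
  simp only [fun S => (R.hasSum_Delta_apply S ξ).tsum_eq.symm]
  refine tendsto_tsum_of_dominated_convergence
    (bound := fun m => ‖T‖ * ‖ξ‖ * (‖R.f m‖ * ‖R.g m‖)) (R.summable_norm_mul.mul_left _) ?_ ?_
  · intro m
    exact (((mulOp ν (R.g m)) ∘L T).continuous.tendsto _).comp (hlim _)
  · refine .of_forall fun n m => ?_
    calc ‖mulOp ν (R.g m) (T (P n (mulOp μ (R.f m) ξ)))‖
        ≤ ‖R.g m‖ * (‖T‖ * (‖R.f m‖ * ‖ξ‖)) := by
          refine ((mulOp ν (R.g m)).le_of_opNorm_le (norm_mulOp_le _ _) _).trans ?_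
          gcongr
          refine (T.le_opNorm _).trans ?_
          gcongr
          exact (hP _ _).trans ((mulOp μ (R.f m)).le_of_opNorm_le (norm_mulOp_le _ _) _)
      _ = ‖T‖ * ‖ξ‖ * (‖R.f m‖ * ‖R.g m‖) := by ring

lemma VInftyRep.Delta_comp_indicatorOp (R : VInftyRep μ ν) (T : Lp ℂ 2 μ →L[ℂ] Lp ℂ 2 ν)
    {U : Set X} (hU : MeasurableSet U) :
    R.Delta (T ∘L indicatorOp μ U hU) = R.Delta T ∘L indicatorOp μ U hU := by
  ext1 ξ
  refine (R.hasSum_Delta_apply _ ξ).unique ?_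
  have hcomm : (fun n => mulOp ν (R.g n) ((T ∘L indicatorOp μ U hU) (mulOp μ (R.f n) ξ))) =
      fun n => mulOp ν (R.g n) (T (mulOp μ (R.f n) (indicatorOp μ U hU ξ))) := by
    funext n
    have h := congrArg (fun S => S ξ) (mulOp_comp_indicatorOp (R.f n) hU)
    simp only [ContinuousLinearMap.comp_apply] at h ⊢
    rw [h]
  rw [hcomm]
  exact R.hasSum_Delta_apply T (indicatorOp μ U hU ξ)

lemma VInftyRep.Delta_indicatorOp_comp (R : VInftyRep μ ν) (T : Lp ℂ 2 μ →L[ℂ] Lp ℂ 2 ν)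
    {V : Set Y} (hV : MeasurableSet V) :
    R.Delta (indicatorOp ν V hV ∘L T) = indicatorOp ν V hV ∘L R.Delta T := by
  ext1 ξ
  refine (R.hasSum_Delta_apply _ ξ).unique ?_
  convert! (R.hasSum_Delta_apply T ξ).mapL (indicatorOp ν V hV) using 2 with n
  exact (congrArg (fun S => S (T (mulOp μ (R.f n) ξ))) (mulOp_comp_indicatorOp (R.g n) hV))

lemma norm_indicatorOp_apply_le {U : Set X} (hU : MeasurableSet U) (ξ : Lp ℂ 2 μ) :
    ‖indicatorOp μ U hU ξ‖ ≤ ‖ξ‖ := by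
  refine Lp.norm_le_norm_of_ae_le ?_
  filter_upwards [indicatorOp_apply_ae hU ξ] with x hx
  rw [hx]
  exact norm_indicator_le_norm_self _ _

/-- An operator supported in `E` vanishes on every measurable rectangle that is disjoint
from `E`. -/
lemma SupportedIn.vanishesOnRect {T : Lp ℂ 2 μ →L[ℂ] Lp ℂ 2 ν} {E : Set (X × Y)}
    (hT : SupportedIn T E) {U : Set X} {V : Set Y} (hU : MeasurableSet U) (hV : MeasurableSet V)
    (h : (U ×ˢ V) ∩ E = ∅) : VanishesOnRect T U V := by
  refine (vanishesOnRect_iff hU hV).2 (hT U V hU hV ?_)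
  exact ⟨∅, ∅, measure_empty, measure_empty, by simp [h]⟩

lemma SupportedIn.of_diff_marginallyNull {T : Lp ℂ 2 μ →L[ℂ] Lp ℂ 2 ν} {E E' : Set (X × Y)}
    (hT : SupportedIn T E) (h : MarginallyNull μ ν (E \ E')) : SupportedIn T E' := by
  intro U V hU hV hUV
  refine hT U V hU hV ((hUV.union h).mono ?_)
  rintro z ⟨hz1, hz2⟩
  by_cases hz : z ∈ E'
  · exact Or.inl ⟨hz1, hz⟩
  · exact Or.inr ⟨hz2, hz⟩

/-- Up to a marginally null set, a pseudo-closed set contains a set whose complement is exactly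
a countable union of measurable rectangles. -/
lemma PseudoClosed.exists_subset {E : Set (X × Y)} (hE : PseudoClosed μ ν E) :
    ∃ (A : ℕ → Set X) (B : ℕ → Set Y), (∀ n, MeasurableSet (A n)) ∧ (∀ n, MeasurableSet (B n)) ∧
      (⋃ n, A n ×ˢ B n)ᶜ ⊆ E ∧ MarginallyNull μ ν (E \ (⋃ n, A n ×ˢ B n)ᶜ) := by
  obtain ⟨A, B, hA, hB, X₁, Y₁, hX₁, hY₁, hsub⟩ := hE
  -- The exceptional null sets are added to the complement of `E` as two further rectangles.
  let A' : ℕ → Set X := fun n => Nat.casesOn n (toMeasurable μ X₁)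
    fun n => Nat.casesOn n Set.univ A
  let B' : ℕ → Set Y := fun n => Nat.casesOn n Set.univ
    fun n => Nat.casesOn n (toMeasurable ν Y₁) B
  have hunion : ⋃ n, A' n ×ˢ B' n =
      (toMeasurable μ X₁ ×ˢ Set.univ ∪ Set.univ ×ˢ toMeasurable ν Y₁) ∪ ⋃ n, A n ×ˢ B n := by
    rw [← Set.union_iUnion_nat_succ, ← Set.union_iUnion_nat_succ, Set.union_assoc]
    rfl
  refine ⟨A', B', ?_, ?_, ?_, toMeasurable μ X₁, toMeasurable ν Y₁, ?_, ?_, ?_⟩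
  · rintro (_ | _ | n)
    exacts [measurableSet_toMeasurable _ _, MeasurableSet.univ, hA n]
  · rintro (_ | _ | n)
    exacts [MeasurableSet.univ, measurableSet_toMeasurable _ _, hB n]
  · intro z hz
    rw [hunion] at hz
    by_contra hzE
    refine hz ?_
    by_cases hz' : z ∈ ⋃ n, A n ×ˢ B n
    · exact Or.inr hz'
    · refine Or.inl ?_
      rcases hsub (Or.inl ⟨hzE, hz'⟩) with h | h
      · exact Or.inl ⟨subset_toMeasurable _ _ h.1, h.2⟩
      · exact Or.inr ⟨h.1, subset_toMeasurable _ _ h.2⟩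
  · rw [measure_toMeasurable, hX₁]
  · rw [measure_toMeasurable, hY₁]
  · rintro z ⟨hzE, hz⟩
    rw [Set.notMem_compl_iff, hunion] at hz
    rcases hz with hz | hz
    · exact hz
    · rcases hsub (Or.inr ⟨hz, fun h => h hzE⟩) with h | h
      · exact Or.inl ⟨subset_toMeasurable _ _ h.1, h.2⟩
      · exact Or.inr ⟨h.1, subset_toMeasurable _ _ h.2⟩

end Basic

/-! ### Compact sets adapted to countably many rectangles -/

section Topology

variable {X Y : Type*} [MeasurableSpace X] [MeasurableSpace Y]

/-- The set of all `y` for which `K` is covered by finitely many of those sets `A n` with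
`y ∈ B n`. -/
def coverSet {ι : Type*} (A : ι → Set X) (B : ι → Set Y) (K : Set X) : Set Y :=
  ⋃ S : {S : Finset ι // K ⊆ ⋃ n ∈ S, A n}, ⋂ n ∈ S.1, B n

/-- `T` vanishes on `K × coverSet A B K`: for a finite set `S` of indices it vanishes on
`(⋃ n ∈ S, A n) × (⋂ n ∈ S, B n)`, and there are only countably many `S`. -/
lemma VanishesOnRect.coverSet {μ : Measure X} {ν : Measure Y} {ι : Type*} [Countable ι]
    {T : Lp ℂ 2 μ →L[ℂ] Lp ℂ 2 ν} {A : ι → Set X} {B : ι → Set Y}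
    (hA : ∀ n, MeasurableSet (A n)) (h : ∀ n, VanishesOnRect T (A n) (B n)) (K : Set X) :
    VanishesOnRect T K (coverSet A B K) := by
  refine VanishesOnRect.iUnion_right fun S => ?_
  refine (VanishesOnRect.biUnion_left hA S.1 fun n hn => ?_).mono S.2 subset_rfl
  exact (h n).mono subset_rfl (Set.biInter_subset_of_mem hn)

/-- If the sets `A n` are relatively open in the compact set `K`, then finitely many of them
suffice to cover `K` whenever all those with `y ∈ B n` do. -/
lemma exists_notMem_of_notMem_coverSet {X Y : Type*} [TopologicalSpace X] {ι : Type*}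
    {A : ι → Set X}
    {B : ι → Set Y} {K : Set X} (hK : IsCompact K) (hKA : ∀ n, IsClosed (K \ A n)) {y : Y}
    (hy : y ∉ coverSet A B K) : ∃ x ∈ K, ∀ n, (x, y) ∉ A n ×ˢ B n := by
  classical
  by_contra! hcon
  obtain ⟨u, hu⟩ := hK.elim_finite_subfamily_closed (fun n : {n // y ∈ B n} => K \ A n)
    (fun n => hKA n) (by
      rw [Set.eq_empty_iff_forall_notMem]
      rintro x ⟨hxK, hx⟩
      obtain ⟨n, hn⟩ := hcon x hxK
      exact (Set.mem_iInter.1 hx ⟨n, hn.2⟩).2 hn.1)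
  refine hy (Set.mem_iUnion.2 ⟨⟨u.image Subtype.val, fun x hx => ?_⟩, ?_⟩)
  · by_contra hxu
    have : x ∈ K ∩ ⋂ i ∈ u, K \ A i.1 := by
      refine ⟨hx, Set.mem_iInter₂.2 fun i hi => ⟨hx, fun hxA => hxu ?_⟩⟩
      exact Set.mem_iUnion₂.2 ⟨i.1, Finset.mem_image_of_mem _ hi, hxA⟩
    rw [hu] at this
    exact this
  · simp only [Set.mem_iInter, Finset.mem_image]
    rintro n ⟨i, _, rfl⟩
    exact i.2

variable [TopologicalSpace X] [T2Space X] [BorelSpace X]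

/-- Inner regularity, applied to `U ∩ A n` and `U \ A n` for all `n` simultaneously, yields a
compact subset of `U` of almost full measure in which every `A n` is relatively open. -/
lemma exists_isCompact_diff_closed (μ : Measure X) [μ.InnerRegularCompactLTTop]
    {ι : Type*} [Countable ι] {A : ι → Set X} (hA : ∀ n, MeasurableSet (A n)) {U : Set X}
    (hU : MeasurableSet U) (hμU : μ U ≠ ∞) {ε : ℝ≥0∞} (hε : ε ≠ 0) :
    ∃ K ⊆ U, IsCompact K ∧ (∀ n, IsClosed (K \ A n)) ∧ μ (U \ K) ≤ ε := by
  rcases isEmpty_or_nonempty ι with hι | hι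
  · obtain ⟨K, hKU, hK, hμ⟩ := hU.exists_isCompact_sdiff_lt hμU hε
    exact ⟨K, hKU, hK, fun n => (IsEmpty.false n).elim, hμ.le⟩
  obtain ⟨δ, hδ, hδsum⟩ := ENNReal.exists_pos_sum_of_countable' hε ι
  have h2 : ∀ n, δ n / 2 ≠ 0 := fun n => (ENNReal.half_pos (hδ n).ne').ne'
  choose K₁ hK₁U hK₁ hμ₁ using fun n => (hU.inter (hA n)).exists_isCompact_sdiff_lt
    (measure_ne_top_of_subset Set.inter_subset_left hμU) (h2 n)
  choose K₂ hK₂U hK₂ hμ₂ using fun n => (hU.diff (hA n)).exists_isCompact_sdiff_lt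
    (measure_ne_top_of_subset Set.sdiff_subset hμU) (h2 n)
  have hKc : IsCompact (⋂ n, (K₁ n ∪ K₂ n)) :=
    ((hK₁ hι.some).union (hK₂ hι.some)).of_isClosed_subset
      (isClosed_iInter fun n => ((hK₁ n).union (hK₂ n)).isClosed) (Set.iInter_subset _ _)
  refine ⟨⋂ n, (K₁ n ∪ K₂ n), ?_, hKc, fun n => ?_, ?_⟩
  · intro x hx
    rcases Set.mem_iInter.1 hx hι.some with h | h
    · exact (hK₁U _ h).1
    · exact (hK₂U _ h).1
  · have : (⋂ n, (K₁ n ∪ K₂ n)) \ A n = (⋂ n, (K₁ n ∪ K₂ n)) ∩ K₂ n := by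
      ext x
      refine ⟨fun hx => ⟨hx.1, ?_⟩, fun hx => ⟨hx.1, (hK₂U n hx.2).2⟩⟩
      exact (Set.mem_iInter.1 hx.1 n).resolve_left fun h => hx.2 (hK₁U n h).2
    rw [this]
    exact hKc.isClosed.inter (hK₂ n).isClosed
  · have hsub : U \ ⋂ n, (K₁ n ∪ K₂ n) ⊆ ⋃ n, ((U ∩ A n) \ K₁ n ∪ (U \ A n) \ K₂ n) := by
      rintro x ⟨hxU, hx⟩
      simp only [Set.mem_iInter, not_forall, Set.mem_union, not_or] at hx
      obtain ⟨n, hn⟩ := hx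
      refine Set.mem_iUnion.2 ⟨n, ?_⟩
      by_cases hxA : x ∈ A n
      · exact Or.inl ⟨⟨hxU, hxA⟩, hn.1⟩
      · exact Or.inr ⟨⟨hxU, hxA⟩, hn.2⟩
    calc μ (U \ ⋂ n, (K₁ n ∪ K₂ n)) ≤ ∑' n, μ ((U ∩ A n) \ K₁ n ∪ (U \ A n) \ K₂ n) :=
          (measure_mono hsub).trans (measure_iUnion_le _)
      _ ≤ ∑' n, δ n := ENNReal.tsum_le_tsum fun n => by
          refine (measure_union_le _ _).trans ?_
          rw [← ENNReal.add_halves (δ n)]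
          exact add_le_add (hμ₁ n).le (hμ₂ n).le
      _ ≤ ε := hδsum.le

/-- Almost all of `X` is exhausted by compact sets in which all the given measurable sets `A n`
are relatively open. -/
lemma exists_isCompact_seq (μ : Measure X) [SigmaFinite μ] [μ.InnerRegularCompactLTTop]
    {ι : Type*} [Countable ι] {A : ι → Set X} (hA : ∀ n, MeasurableSet (A n)) {U : ℕ → Set X}
    (hU : ∀ i, MeasurableSet (U i)) (hUx : ∀ x, ∀ᶠ i in Filter.atTop, x ∈ U i) :
    ∃ K : ℕ → Set X, (∀ i, K i ⊆ U i) ∧ (∀ i, IsCompact (K i)) ∧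
      (∀ i n, IsClosed (K i \ A n)) ∧ (∀ i, μ (K i) ≠ ∞) ∧
      ∀ᵐ x ∂μ, ∀ᶠ i in Filter.atTop, x ∈ K i := by
  obtain ⟨δ, hδ, hδsum⟩ := ENNReal.exists_pos_sum_of_countable' one_ne_zero ℕ
  have hfin : ∀ i, μ (U i ∩ spanningSets μ i) ≠ ∞ := fun i =>
    measure_ne_top_of_subset Set.inter_subset_right (measure_spanningSets_lt_top μ i).ne
  choose K hKU hK hKA hμ using fun i => exists_isCompact_diff_closed μ hA
    ((hU i).inter (measurableSet_spanningSets μ i)) (hfin i) (hδ i).ne'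
  refine ⟨K, fun i => (hKU i).trans Set.inter_subset_left, hK, hKA,
    fun i => measure_ne_top_of_subset (hKU i) (hfin i), ?_⟩
  -- The Borel–Cantelli lemma, for the parts of `U i ∩ spanningSets μ i` that `K i` misses.
  have hsum : ∑' i, μ ((U i ∩ spanningSets μ i) \ K i) ≠ ∞ :=
    ((ENNReal.tsum_le_tsum hμ).trans_lt (hδsum.trans ENNReal.one_lt_top)).ne
  filter_upwards [ae_eventually_notMem hsum] with x hx
  filter_upwards [hx, hUx x, Filter.eventually_ge_atTop (spanningSetsIndex μ x)] with i h1 h2 h3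
  by_contra hxK
  exact h1 ⟨⟨h2, mem_spanningSets_of_index_le μ x h3⟩, hxK⟩

/-- An operator that vanishes on countably many measurable rectangles which cover `X × Y` is
zero. -/
lemma eq_zero_of_vanishesOnRect_of_cover {μ : Measure X} [SigmaFinite μ]
    [μ.InnerRegularCompactLTTop] {ν : Measure Y} {ι : Type*} [Countable ι]
    {T : Lp ℂ 2 μ →L[ℂ] Lp ℂ 2 ν} {A : ι → Set X} {B : ι → Set Y}
    (hA : ∀ n, MeasurableSet (A n)) (hcov : ∀ x y, ∃ n, x ∈ A n ∧ y ∈ B n)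
    (h : ∀ n, VanishesOnRect T (A n) (B n)) : T = 0 := by
  obtain ⟨K, -, hK, hKA, -, hlim⟩ := exists_isCompact_seq μ hA (U := fun _ => Set.univ)
    (fun _ => MeasurableSet.univ) (fun x => .of_forall fun _ => Set.mem_univ x)
  have hcover : ∀ i, coverSet A B (K i) = Set.univ := by
    intro i
    refine Set.eq_univ_of_forall fun y => ?_
    by_contra hy
    obtain ⟨x, -, hx⟩ := exists_notMem_of_notMem_coverSet (hK i) (hKA i) hy
    obtain ⟨n, hn⟩ := hcov x y
    exact hx n hn
  have hzero : ∀ i ξ, T (indicatorOp μ (K i) (hK i).measurableSet ξ) = 0 := by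
    intro i ξ
    have := VanishesOnRect.coverSet hA h (K i) _
      (indicatorOp_apply_eq_zero_of_notMem (hK i).measurableSet ξ)
    rw [hcover i] at this
    refine Lp.ext (Filter.EventuallyEq.trans ?_ (Lp.coeFn_zero _ _ _).symm)
    filter_upwards [this] with y hy
    exact hy (Set.mem_univ y)
  ext1 ξ
  refine tendsto_nhds_unique
    ((T.continuous.tendsto _).comp (tendsto_indicatorOp (fun i => (hK i).measurableSet) hlim ξ)) ?_
  refine tendsto_const_nhds.congr fun i => ?_
  simp [hzero i ξ]

end Topology

/-! ### Partitions controlled by the Hausdorff measure -/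

section Hausdorff

variable {X : Type*} [MetricSpace X] [MeasurableSpace X] [BorelSpace X]

open Metric in
/-- A set of finite diameter can be enlarged to an open set at an arbitrarily small cost in the
`s`-th power of the diameter. The supremum makes the empty set count as `0`, as in the
definition of the Hausdorff measure. -/
lemma exists_thickening_ediam_rpow_le {X : Type*} [MetricSpace X] {s : ℝ}
    (hs : 0 < s) {t : Set X} {r : ℝ≥0∞} (hr : r ≠ ∞) (hr0 : r ≠ 0) (ht : ediam t ≤ r / 2)
    {ε : ℝ≥0∞} (hε : ε ≠ 0) :
    ∃ δ : ℝ≥0, 0 < δ ∧ ediam (thickening δ t) ≤ r ∧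
      ediam (thickening δ t) ^ s ≤ (⨆ _ : t.Nonempty, ediam t ^ s) + ε := by
  rcases t.eq_empty_or_nonempty with rfl | hne
  · refine ⟨1, one_pos, ?_⟩
    simp [hs]
  have hd : ediam t ≠ ∞ := (ht.trans_lt (ENNReal.half_lt_self hr0 hr |>.trans hr.lt_top)).ne
  have hcont : Filter.Tendsto (fun δ : ℝ≥0 => (ediam t + 2 * (δ : ℝ≥0∞)) ^ s) (nhds 0)
      (nhds (ediam t ^ s)) := by
    have h1 : Continuous fun δ : ℝ≥0 => (ediam t + 2 * (δ : ℝ≥0∞)) ^ s :=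
      ENNReal.continuous_rpow_const.comp (continuous_const.add
        ((ENNReal.continuous_const_mul ENNReal.ofNat_ne_top).comp ENNReal.continuous_coe))
    simpa using h1.tendsto 0
  have hlt : ediam t ^ s < ediam t ^ s + ε :=
    ENNReal.lt_add_right (ENNReal.rpow_ne_top_of_nonneg hs.le hd) hε
  -- A radius below `r / 4` adds less than `r / 2` to the diameter.
  have hr4 : (0 : ℝ≥0) < r.toNNReal / 4 := div_pos (ENNReal.toNNReal_pos hr0 hr) (by norm_num)
  obtain ⟨δ, ⟨h1, h2⟩, hδ⟩ := (((hcont.eventually_lt_const hlt).and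
    (eventually_lt_nhds hr4)).filter_mono nhdsWithin_le_nhds |>.and
      (self_mem_nhdsWithin (a := (0 : ℝ≥0)) (s := Set.Ioi 0))).exists
  have hthick := ediam_thickening_le (s := t) δ
  refine ⟨δ, hδ, hthick.trans ?_, ?_⟩
  · have h3 : (2 * δ : ℝ≥0∞) ≤ r / 2 := by
      rw [← ENNReal.coe_toNNReal hr]
      have : 2 * δ ≤ r.toNNReal / 2 := by
        rw [← NNReal.coe_le_coe]
        have := NNReal.coe_lt_coe.2 h2
        push_cast at this ⊢
        linarith
      exact_mod_cast this
    exact (add_le_add ht h3).trans_eq (ENNReal.add_halves r)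
  · simp only [hne, ciSup_pos]
    exact (ENNReal.rpow_le_rpow hthick hs.le).trans h1.le

open Metric Measure in
/-- A compact set `G` of finite `s`-dimensional Hausdorff measure has finite measurable partitions
into sets of small diameter for which the sums of the `s`-th powers of the diameters are
bounded. -/
lemma exists_finite_partition {s : ℝ} (hs : 0 < s) {G : Set X} (hG : IsCompact G)
    (hGs : μH[s] G ≠ ∞) {r : ℝ≥0∞} (hr0 : r ≠ 0) :
    ∃ (N : ℕ) (D : Fin N → Set X), (∀ i, MeasurableSet (D i)) ∧
      Pairwise (Function.onFun Disjoint D) ∧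
      ⋃ i, D i = G ∧ (∀ i, ediam (D i) ≤ r) ∧ ∑ i, ediam (D i) ^ s ≤ μH[s] G + 1 := by
  wlog hr : r ≠ ∞ generalizing r
  · obtain ⟨N, D, h1, h2, h3, h4, h5⟩ := this (r := 1) one_ne_zero ENNReal.one_ne_top
    exact ⟨N, D, h1, h2, h3, fun i => by simp [not_not.1 hr], h5⟩
  have hhalf : (2⁻¹ : ℝ≥0∞) ≠ 0 := by simp
  have hlt : μH[s] G < μH[s] G + 2⁻¹ := ENNReal.lt_add_right hGs hhalf
  have hle : ⨅ (t : ℕ → Set X) (_ : G ⊆ ⋃ n, t n) (_ : ∀ n, ediam (t n) ≤ r / 2),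
      ∑' n, ⨆ _ : (t n).Nonempty, ediam (t n) ^ s ≤ μH[s] G := by
    rw [hausdorffMeasure_apply]
    exact le_iSup₂_of_le (r / 2) (ENNReal.half_pos hr0) le_rfl
  have hex := hle.trans_lt hlt
  simp only [iInf_lt_iff] at hex
  obtain ⟨t, htG, htr, hsum⟩ := hex
  obtain ⟨ε, hε, hεsum⟩ := ENNReal.exists_pos_sum_of_countable' hhalf ℕ
  choose δ hδ hdiam hpow using fun n =>
    exists_thickening_ediam_rpow_le hs hr hr0 (htr n) (hε n).ne'
  obtain ⟨S, hS⟩ := hG.elim_finite_subcover (fun n => thickening (δ n) (t n))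
    (fun n => isOpen_thickening) (htG.trans (Set.iUnion_mono fun n =>
      self_subset_thickening (by exact_mod_cast hδ n) _))
  obtain ⟨N, hN⟩ := S.exists_nat_subset_range
  -- Making the finite cover by thickenings disjoint does not increase the diameters.
  let A : ℕ → Set X := fun n => G ∩ thickening (δ n) (t n)
  have hAm : ∀ n, MeasurableSet (A n) := fun n =>
    hG.measurableSet.inter isOpen_thickening.measurableSet
  have hsub : ∀ n, disjointed A n ⊆ thickening (δ n) (t n) := fun n =>
    (disjointed_subset A n).trans Set.inter_subset_right
  refine ⟨N, fun i => disjointed A i, fun i => MeasurableSet.disjointed hAm i,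
    fun i j hij => disjoint_disjointed A fun h => hij (Fin.ext h), ?_,
    fun i => (ediam_mono (hsub i)).trans (hdiam i), ?_⟩
  · refine Set.Subset.antisymm
      (Set.iUnion_subset fun i => (disjointed_subset A i).trans Set.inter_subset_left) ?_
    intro x hx
    obtain ⟨n, hnS, hn⟩ := Set.mem_iUnion₂.1 (hS hx)
    have hxA : x ∈ ⋃ k ∈ Finset.range (n + 1), disjointed A k := by
      rw [biUnion_range_succ_disjointed]
      exact le_partialSups A n ⟨hx, hn⟩
    obtain ⟨k, hk, hxk⟩ := Set.mem_iUnion₂.1 hxA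
    have hkN := (Nat.lt_succ_iff.1 (Finset.mem_range.1 hk)).trans_lt (Finset.mem_range.1 (hN hnS))
    exact Set.mem_iUnion.2 ⟨⟨k, hkN⟩, hxk⟩
  · calc ∑ i : Fin N, ediam (disjointed A i) ^ s
        ≤ ∑ i : Fin N, ((⨆ _ : (t i).Nonempty, ediam (t i) ^ s) + ε i) :=
          Finset.sum_le_sum fun i _ =>
            (ENNReal.rpow_le_rpow (ediam_mono (hsub i)) hs.le).trans (hpow i)
      _ = ∑ i ∈ Finset.range N, ((⨆ _ : (t i).Nonempty, ediam (t i) ^ s) + ε i) :=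
          Fin.sum_univ_eq_sum_range (fun i => (⨆ _ : (t i).Nonempty, ediam (t i) ^ s) + ε i) N
      _ ≤ ∑' n, ((⨆ _ : (t n).Nonempty, ediam (t n) ^ s) + ε n) := ENNReal.sum_le_tsum _
      _ = (∑' n, ⨆ _ : (t n).Nonempty, ediam (t n) ^ s) + ∑' n, ε n := ENNReal.tsum_add
      _ ≤ (μH[s] G + 2⁻¹) + 2⁻¹ := add_le_add hsum.le hεsum.le
      _ = μH[s] G + 1 := by rw [add_assoc, ENNReal.inv_two_add_inv_two]

end Hausdorff

/-! ### Kernels of rank one operators -/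

section Kernel

open ComplexConjugate InnerProductSpace

variable {X Y : Type*} [MeasurableSpace X] [MeasurableSpace Y] {μ : Measure X} {ν : Measure Y}

lemma ae_norm_le_norm_Lp_top (f : Lp ℂ ∞ μ) : ∀ᵐ x ∂μ, ‖f x‖ ≤ ‖f‖ := by
  filter_upwards [enorm_ae_le_eLpNormEssSup f μ] with x hx
  rw [← eLpNorm_exponent_top, ← Lp.enorm_def] at hx
  exact enorm_le_iff_norm_le.1 hx

lemma lintegral_enorm_sq (ξ : Lp ℂ 2 μ) : ∫⁻ x, ‖ξ x‖ₑ ^ (2 : ℝ) ∂μ = ‖ξ‖ₑ ^ (2 : ℝ) := by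
  rw [Lp.enorm_def, eLpNorm_eq_lintegral_rpow_enorm_toReal two_ne_zero ENNReal.ofNat_ne_top,
    ← ENNReal.rpow_mul]
  simp

lemma VInftyRep.Represents.aestronglyMeasurable [SFinite μ] [SFinite ν] {R : VInftyRep μ ν}
    {F : X → Y → ℂ} (hR : R.Represents F) :
    AEStronglyMeasurable (fun z : X × Y => F z.1 z.2) (μ.prod ν) := by
  refine aestronglyMeasurable_of_tendsto_ae Filter.atTop
    (f := fun N z => ∑ n ∈ Finset.range N, R.f n z.1 * R.g n z.2) (fun N => ?_) ?_
  · refine Finset.aestronglyMeasurable_fun_sum _ fun n _ => ?_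
    exact (Lp.aestronglyMeasurable (R.f n)).comp_fst.mul
      (Lp.aestronglyMeasurable (R.g n)).comp_snd
  · filter_upwards [hR.ae] with z hz
    exact hz.tendsto_sum_nat

lemma VInftyRep.Represents.ae_norm_le [SFinite μ] [SFinite ν] {R : VInftyRep μ ν}
    {F : X → Y → ℂ} (hR : R.Represents F) :
    ∀ᵐ z ∂μ.prod ν, ‖F z.1 z.2‖ ≤ ∑' n, ‖R.f n‖ * ‖R.g n‖ := by
  have hf : ∀ᵐ z ∂μ.prod ν, ∀ n, ‖R.f n z.1‖ ≤ ‖R.f n‖ :=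
    Measure.quasiMeasurePreserving_fst.ae (ae_all_iff.2 fun n => ae_norm_le_norm_Lp_top (R.f n))
  have hg : ∀ᵐ z ∂μ.prod ν, ∀ n, ‖R.g n z.2‖ ≤ ‖R.g n‖ :=
    Measure.quasiMeasurePreserving_snd.ae (ae_all_iff.2 fun n => ae_norm_le_norm_Lp_top (R.g n))
  filter_upwards [hR.ae, hf, hg] with z hz h1 h2
  rw [← hz.tsum_eq]
  refine tsum_of_norm_bounded R.summable_norm_mul.hasSum fun n => ?_
  rw [norm_mul]
  exact mul_le_mul (h1 n) (h2 n) (norm_nonneg _) (norm_nonneg _)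

lemma integrable_mul_conj (a b : Lp ℂ 2 μ) : Integrable (fun x => a x * conj (b x)) μ :=
  L2.integrable_inner (𝕜 := ℂ) b a

/-- The operator `Δ_F` multiplies the kernel of a rank one operator by `F`. -/
lemma VInftyRep.Represents.inner_Delta_rankOne [SigmaFinite μ] [SigmaFinite ν]
    {R : VInftyRep μ ν} {F : X → Y → ℂ} (hR : R.Represents F) (e ξ : Lp ℂ 2 μ) (τ η : Lp ℂ 2 ν) :
    Integrable (fun z : X × Y =>
      F z.1 z.2 * ((ξ z.1 * conj (e z.1)) * (τ z.2 * conj (η z.2)))) (μ.prod ν) ∧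
    inner ℂ η (R.Delta (rankOne ℂ τ e) ξ) =
      ∫ z, F z.1 z.2 * ((ξ z.1 * conj (e z.1)) * (τ z.2 * conj (η z.2))) ∂μ.prod ν := by
  set p : X → ℂ := fun x => ξ x * conj (e x)
  set q : Y → ℂ := fun y => τ y * conj (η y)
  have hp : Integrable p μ := integrable_mul_conj ξ e
  have hq : Integrable q ν := integrable_mul_conj τ η
  have hpq : Integrable (fun z : X × Y => p z.1 * q z.2) (μ.prod ν) := hp.mul_prod hq
  have hfp : ∀ n, Integrable (fun x => R.f n x * p x) μ := fun n =>
    hp.bdd_mul (Lp.aestronglyMeasurable _) (ae_norm_le_norm_Lp_top (R.f n))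
  have hgq : ∀ n, Integrable (fun y => R.g n y * q y) ν := fun n =>
    hq.bdd_mul (Lp.aestronglyMeasurable _) (ae_norm_le_norm_Lp_top (R.g n))
  refine ⟨hpq.bdd_mul hR.aestronglyMeasurable hR.ae_norm_le, ?_⟩
  have hint : ∀ n, Integrable (fun z : X × Y => (R.f n z.1 * p z.1) * (R.g n z.2 * q z.2))
      (μ.prod ν) := fun n => (hfp n).mul_prod (hgq n)
  have hnf : ∀ n, ∫ x, ‖R.f n x * p x‖ ∂μ ≤ ‖R.f n‖ * ∫ x, ‖p x‖ ∂μ := by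
    intro n
    rw [← integral_const_mul]
    refine integral_mono_ae (hfp n).norm (hp.norm.const_mul _) ?_
    filter_upwards [ae_norm_le_norm_Lp_top (R.f n)] with x hx
    rw [norm_mul]
    gcongr
  have hng : ∀ n, ∫ y, ‖R.g n y * q y‖ ∂ν ≤ ‖R.g n‖ * ∫ y, ‖q y‖ ∂ν := by
    intro n
    rw [← integral_const_mul]
    refine integral_mono_ae (hgq n).norm (hq.norm.const_mul _) ?_
    filter_upwards [ae_norm_le_norm_Lp_top (R.g n)] with x hx
    rw [norm_mul]
    gcongr
  have hsummable : Summable fun n =>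
      ∫ z : X × Y, ‖(R.f n z.1 * p z.1) * (R.g n z.2 * q z.2)‖ ∂μ.prod ν := by
    refine Summable.of_nonneg_of_le (fun n => by positivity) (fun n => ?_)
      (R.summable_norm_mul.mul_right ((∫ x, ‖p x‖ ∂μ) * ∫ y, ‖q y‖ ∂ν))
    simp only [norm_mul _ (R.g n _ * q _)]
    rw [integral_prod_mul (fun x => ‖R.f n x * p x‖) (fun y => ‖R.g n y * q y‖)]
    calc _ ≤ (‖R.f n‖ * ∫ x, ‖p x‖ ∂μ) * (‖R.g n‖ * ∫ y, ‖q y‖ ∂ν) := by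
          exact mul_le_mul (hnf n) (hng n) (by positivity) (by positivity)
      _ = _ := by ring
  have h1 := hasSum_integral_of_summable_integral_norm hint hsummable
  have h2 : HasSum (fun n => ∫ z : X × Y, (R.f n z.1 * p z.1) * (R.g n z.2 * q z.2) ∂μ.prod ν)
      (inner ℂ η (R.Delta (rankOne ℂ τ e) ξ)) := by
    have h3 := (R.hasSum_Delta_apply (rankOne ℂ τ e) ξ).mapL (innerSL ℂ η)
    convert! h3 using 2 with n
    rw [rankOne_apply, map_smul, map_smul, smul_eq_mul,
      innerSL_apply_apply, L2.inner_def, L2.inner_def,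
      integral_prod_mul (fun x => R.f n x * p x) (fun y => R.g n y * q y)]
    congr 1 <;> refine integral_congr_ae ?_
    · filter_upwards [mulOp_apply_ae (R.f n) ξ] with x hx
      rw [hx, RCLike.inner_apply, mul_assoc]
    · filter_upwards [mulOp_apply_ae (R.g n) τ] with y hy
      rw [hy, RCLike.inner_apply, mul_assoc]
  rw [h2.unique h1]
  refine integral_congr_ae ?_
  filter_upwards [hR.ae] with z hz
  rw [← hz.tsum_eq, ← tsum_mul_right]
  exact tsum_congr fun n => by ring

/-- If `|F|` is at most `c` on the part of the support of the kernel `τ ⊗ e` of a rank one operator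
where it does not vanish, and that part lies in `W`, then the matrix coefficients of
`Δ_F(τ ⊗ e)`, extended linearly to finite sums of elementary tensors, are bounded by the `L²` norm
over `W` of the sum. -/
lemma VInftyRep.Represents.enorm_sum_inner_Delta_rankOne_le [SigmaFinite μ] [SigmaFinite ν]
    {R : VInftyRep μ ν} {F : X → Y → ℂ} (hR : R.Represents F) {e : Lp ℂ 2 μ} {τ : Lp ℂ 2 ν}
    {c : ℝ≥0∞} {W : Set (X × Y)} (hW : MeasurableSet W)
    (hbound : ∀ᵐ z ∂μ.prod ν, F z.1 z.2 ≠ 0 → e z.1 ≠ 0 → τ z.2 ≠ 0 →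
      z ∈ W ∧ ‖F z.1 z.2‖ₑ ≤ c) {κ : Type*} [Fintype κ] (ξ : κ → Lp ℂ 2 μ) (η : κ → Lp ℂ 2 ν) :
    ‖∑ i, inner ℂ (η i) (R.Delta (rankOne ℂ τ e) (ξ i))‖ₑ ≤
      c * (‖e‖ₑ * ‖τ‖ₑ) *
        (∫⁻ z in W, ‖∑ i, ξ i z.1 * conj (η i z.2)‖ₑ ^ (2 : ℝ) ∂μ.prod ν) ^ (1 / 2 : ℝ) := by
  have hem : AEMeasurable (fun z : X × Y => ‖e z.1‖ₑ) (μ.prod ν) :=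
    (Lp.aestronglyMeasurable e).comp_fst.enorm
  have hτm : AEMeasurable (fun z : X × Y => ‖τ z.2‖ₑ) (μ.prod ν) :=
    (Lp.aestronglyMeasurable τ).comp_snd.enorm
  have hHm : AEMeasurable (fun z : X × Y => ‖∑ i, ξ i z.1 * conj (η i z.2)‖ₑ) (μ.prod ν) := by
    refine AEStronglyMeasurable.enorm (Finset.aestronglyMeasurable_fun_sum _ fun i _ => ?_)
    exact (Lp.aestronglyMeasurable (ξ i)).comp_fst.mul
      (RCLike.continuous_conj.comp_aestronglyMeasurable (Lp.aestronglyMeasurable (η i)).comp_snd)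
  have heτ : ∫⁻ z, (‖e z.1‖ₑ * ‖τ z.2‖ₑ) ^ (2 : ℝ) ∂μ.prod ν = (‖e‖ₑ * ‖τ‖ₑ) ^ (2 : ℝ) := by
    simp only [ENNReal.mul_rpow_of_nonneg _ _ zero_le_two]
    rw [lintegral_prod_mul (f := fun x => ‖e x‖ₑ ^ (2 : ℝ)) (g := fun y => ‖τ y‖ₑ ^ (2 : ℝ))
      ((Lp.aestronglyMeasurable e).enorm.pow_const _)
      ((Lp.aestronglyMeasurable τ).enorm.pow_const _), lintegral_enorm_sq, lintegral_enorm_sq]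
  have hsum : ∑ i, inner ℂ (η i) (R.Delta (rankOne ℂ τ e) (ξ i)) =
      ∫ z, F z.1 z.2 * (conj (e z.1) * τ z.2) * ∑ i, ξ i z.1 * conj (η i z.2) ∂μ.prod ν := by
    rw [Finset.sum_congr rfl fun i _ => (hR.inner_Delta_rankOne e (ξ i) τ (η i)).2,
      ← integral_finsetSum _ fun i _ => (hR.inner_Delta_rankOne e (ξ i) τ (η i)).1]
    refine integral_congr_ae (.of_forall fun z => ?_)
    simp only [Finset.mul_sum]
    exact Finset.sum_congr rfl fun i _ => by ring
  rw [hsum]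
  calc ‖∫ z, F z.1 z.2 * (conj (e z.1) * τ z.2) * ∑ i, ξ i z.1 * conj (η i z.2) ∂μ.prod ν‖ₑ
      ≤ ∫⁻ z, ‖F z.1 z.2 * (conj (e z.1) * τ z.2) * ∑ i, ξ i z.1 * conj (η i z.2)‖ₑ ∂μ.prod ν :=
        enorm_integral_le_lintegral_enorm _
    _ ≤ ∫⁻ z, c * ((‖e z.1‖ₑ * ‖τ z.2‖ₑ) *
          W.indicator (fun z => ‖∑ i, ξ i z.1 * conj (η i z.2)‖ₑ) z) ∂μ.prod ν := by
        refine lintegral_mono_ae ?_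
        filter_upwards [hbound] with z hz
        by_cases hz0 : F z.1 z.2 ≠ 0 ∧ e z.1 ≠ 0 ∧ τ z.2 ≠ 0
        · obtain ⟨hzW, hzc⟩ := hz hz0.1 hz0.2.1 hz0.2.2
          rw [Set.indicator_of_mem hzW, enorm_mul, enorm_mul, enorm_mul, RCLike.enorm_conj,
            ← mul_assoc c]
          gcongr
        · have : F z.1 z.2 * (conj (e z.1) * τ z.2) = 0 := by
            by_contra h
            exact hz0 ⟨left_ne_zero_of_mul h,
              fun h' => h (by simp [h']), fun h' => h (by simp [h'])⟩
          simp [this]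
    _ = c * ∫⁻ z, (‖e z.1‖ₑ * ‖τ z.2‖ₑ) *
          W.indicator (fun z => ‖∑ i, ξ i z.1 * conj (η i z.2)‖ₑ) z ∂μ.prod ν :=
        lintegral_const_mul'' _ ((hem.mul hτm).mul (hHm.indicator hW))
    _ ≤ c * ((∫⁻ z, (‖e z.1‖ₑ * ‖τ z.2‖ₑ) ^ (2 : ℝ) ∂μ.prod ν) ^ (1 / 2 : ℝ) *
          (∫⁻ z, (W.indicator (fun z => ‖∑ i, ξ i z.1 * conj (η i z.2)‖ₑ) z) ^ (2 : ℝ)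
            ∂μ.prod ν) ^ (1 / 2 : ℝ)) := by
        gcongr
        exact ENNReal.lintegral_mul_le_Lp_mul_Lq _ Real.HolderConjugate.two_two (hem.mul hτm)
          (hHm.indicator hW)
    _ = _ := by
        have hind : ∫⁻ z, (W.indicator (fun z => ‖∑ i, ξ i z.1 * conj (η i z.2)‖ₑ) z) ^ (2 : ℝ)
            ∂μ.prod ν = ∫⁻ z in W, ‖∑ i, ξ i z.1 * conj (η i z.2)‖ₑ ^ (2 : ℝ) ∂μ.prod ν := by
          rw [← lintegral_indicator hW]
          refine lintegral_congr fun z => ?_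
          by_cases hz : z ∈ W <;> simp [hz]
        rw [heτ, hind, ← ENNReal.rpow_mul, show (2 : ℝ) * (1 / 2) = 1 by norm_num,
          ENNReal.rpow_one, ← mul_assoc]

end Kernel

section Projection

open InnerProductSpace

variable {H : Type*} [NormedAddCommGroup H] [InnerProductSpace ℂ H] {κ : Type*} [Fintype κ]

/-- The sum of the projections onto finitely many orthonormal vectors is the orthogonal projection
onto a subspace that contains them. -/
lemma sum_rankOne_eq_starProjection {v : κ → H} (hv : Orthonormal ℂ v) :
    ∃ U : Submodule ℂ H, ∃ _ : U.HasOrthogonalProjection, (∀ i, v i ∈ U) ∧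
      ∑ i, rankOne ℂ (v i) (v i) = U.starProjection := by
  classical
  let b := OrthonormalBasis.span hv Finset.univ
  refine ⟨Submodule.span ℂ (Finset.univ.image v : Set H), inferInstance, fun i => ?_, ?_⟩
  rotate_left
  · rw [OrthonormalBasis.starProjection_eq_sum_rankOne b]
    simp only [b, OrthonormalBasis.span_apply]
    exact (Finset.sum_coe_sort Finset.univ fun i => rankOne ℂ (v i) (v i)).symm
  · exact Submodule.subset_span (by simp)

end Projection

/-! ### Operators with square integrable kernels -/

section Exhaustion

open ComplexConjugate

variable {X Y : Type*} [MeasurableSpace X] [MeasurableSpace Y] {μ : Measure X} {ν : Measure Y}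

lemma VanishesOnRect.inner_indicatorOp_eq_zero {S : Lp ℂ 2 μ →L[ℂ] Lp ℂ 2 ν} {U : Set X}
    {V : Set Y} (h : VanishesOnRect S U V) (hU : MeasurableSet U) (hV : MeasurableSet V)
    (ξ : Lp ℂ 2 μ) (η : Lp ℂ 2 ν) :
    inner ℂ (indicatorOp ν V hV η) (S (indicatorOp μ U hU ξ)) = 0 := by
  rw [L2.inner_def]
  refine integral_eq_zero_of_ae ?_
  filter_upwards [h _ (indicatorOp_apply_eq_zero_of_notMem hU ξ),
    indicatorOp_apply_eq_zero_of_notMem hV η] with y h1 h2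
  by_cases hy : y ∈ V
  · simp [h1 hy]
  · simp [h2 hy]

lemma VanishesOnRect.Delta {R : VInftyRep μ ν} {T : Lp ℂ 2 μ →L[ℂ] Lp ℂ 2 ν} {U : Set X}
    {V : Set Y} (h : VanishesOnRect T U V) (hU : MeasurableSet U) (hV : MeasurableSet V) :
    VanishesOnRect (R.Delta T) U V := by
  rw [vanishesOnRect_iff hU hV] at h ⊢
  rw [← R.Delta_comp_indicatorOp, ← R.Delta_indicatorOp_comp, h, map_zero]

lemma VanishesOnRect.comp_indicatorOp {T : Lp ℂ 2 μ →L[ℂ] Lp ℂ 2 ν} {U G : Set X}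
    {V : Set Y} (h : VanishesOnRect T U V) (hG : MeasurableSet G) :
    VanishesOnRect (T ∘L indicatorOp μ G hG) U V := by
  intro ξ hξ
  refine h (indicatorOp μ G hG ξ) ?_
  filter_upwards [hξ, indicatorOp_apply_ae hG ξ] with x h1 h2 hx
  rw [h2]
  by_cases hxG : x ∈ G <;> simp [hxG, h1 hx]

/-- Removing finitely many of the rectangles on which `S` vanishes from the elementary tensor
`ξ ⊗ η` gives a finite sum of elementary tensors with the same matrix coefficient. -/
lemma exists_elementary_tensors {S : Lp ℂ 2 μ →L[ℂ] Lp ℂ 2 ν} [SFinite μ] [SFinite ν]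
    {A : ℕ → Set X} {B : ℕ → Set Y} (hA : ∀ n, MeasurableSet (A n)) (hB : ∀ n, MeasurableSet (B n))
    (h : ∀ n, VanishesOnRect S (A n) (B n)) (ξ : Lp ℂ 2 μ) (η : Lp ℂ 2 ν) (N : ℕ) :
    ∃ (κ : Type) (_ : Fintype κ) (ξ' : κ → Lp ℂ 2 μ) (η' : κ → Lp ℂ 2 ν),
      ∑ i, inner ℂ (η' i) (S (ξ' i)) = inner ℂ η (S ξ) ∧
      ∀ᵐ z ∂μ.prod ν, ∑ i, ξ' i z.1 * conj (η' i z.2) =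
        (⋃ n < N, A n ×ˢ B n)ᶜ.indicator (fun z => ξ z.1 * conj (η z.2)) z := by
  induction N with
  | zero => exact ⟨Unit, inferInstance, fun _ => ξ, fun _ => η, by simp, by simp⟩
  | succ N ih =>
    obtain ⟨κ, _, ξ', η', hsum, hae⟩ := ih
    refine ⟨κ ⊕ κ, inferInstance, Sum.elim ξ' fun i => -indicatorOp μ (A N) (hA N) (ξ' i),
      Sum.elim η' fun i => indicatorOp ν (B N) (hB N) (η' i), ?_, ?_⟩
    -- The new summands are `-P(A N) ξᵢ ⊗ Q(B N) ηᵢ`, whose matrix coefficients vanish.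
    · simp [Fintype.sum_sum_type, hsum, (h N).inner_indicatorOp_eq_zero (hA N) (hB N)]
    · have hξ : ∀ᵐ z ∂μ.prod ν, ∀ i, (-indicatorOp μ (A N) (hA N) (ξ' i)) z.1 =
          -(A N).indicator (ξ' i) z.1 := by
        refine Measure.quasiMeasurePreserving_fst.ae (p := fun x => ∀ i,
          (-indicatorOp μ (A N) (hA N) (ξ' i)) x = -(A N).indicator (ξ' i) x)
          (ae_all_iff.2 fun i => ?_)
        filter_upwards [Lp.coeFn_neg (indicatorOp μ (A N) (hA N) (ξ' i)),
          indicatorOp_apply_ae (hA N) (ξ' i)] with x h1 h2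
        rw [h1, Pi.neg_apply, h2]
      have hη : ∀ᵐ z ∂μ.prod ν, ∀ i, indicatorOp ν (B N) (hB N) (η' i) z.2 =
          (B N).indicator (η' i) z.2 :=
        Measure.quasiMeasurePreserving_snd.ae (p := fun y => ∀ i,
          indicatorOp ν (B N) (hB N) (η' i) y = (B N).indicator (η' i) y)
          (ae_all_iff.2 fun i => indicatorOp_apply_ae (hB N) (η' i))
      filter_upwards [hae, hξ, hη] with z h1 h2 h3
      have hU : (⋃ n < N + 1, A n ×ˢ B n) = (⋃ n < N, A n ×ˢ B n) ∪ A N ×ˢ B N :=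
        Set.biUnion_lt_succ _ N
      simp only [Fintype.sum_sum_type, Sum.elim_inl, Sum.elim_inr, h2, h3, h1]
      by_cases hz : z.1 ∈ A N ∧ z.2 ∈ B N
      · have : ∑ i, -(A N).indicator (ξ' i) z.1 * conj ((B N).indicator (η' i) z.2) =
            -∑ i, ξ' i z.1 * conj (η' i z.2) := by
          simp [hz.1, hz.2]
        rw [this, h1, add_neg_cancel, Set.indicator_of_notMem]
        rw [Set.notMem_compl_iff, hU]
        exact Or.inr hz
      · have : ∑ i, -(A N).indicator (ξ' i) z.1 * conj ((B N).indicator (η' i) z.2) = 0 := by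
          refine Finset.sum_eq_zero fun i _ => ?_
          rcases not_and_or.1 hz with h | h <;> simp [h]
        rw [this, add_zero, hU]
        by_cases hz' : z ∈ ⋃ n < N, A n ×ˢ B n
        · rw [Set.indicator_of_notMem (Set.notMem_compl_iff.2 hz'),
            Set.indicator_of_notMem (Set.notMem_compl_iff.2 (Set.mem_union_left _ hz'))]
        · rw [Set.indicator_of_mem hz', Set.indicator_of_mem]
          rintro (h | h)
          exacts [hz' h, hz h]

/-- An operator vanishes if it vanishes on all the rectangles `A n × B n` and if its kernel is
square integrable on their union and zero outside of it, in the weak sense expressed by `hM`. -/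
lemma eq_zero_of_vanishesOnRect_of_bound {S : Lp ℂ 2 μ →L[ℂ] Lp ℂ 2 ν} [SigmaFinite μ]
    [SigmaFinite ν] {A : ℕ → Set X} {B : ℕ → Set Y} (hA : ∀ n, MeasurableSet (A n))
    (hB : ∀ n, MeasurableSet (B n)) (h : ∀ n, VanishesOnRect S (A n) (B n)) {M : ℝ≥0∞}
    (hMtop : M ≠ ∞)
    (hM : ∀ (κ : Type) [Fintype κ] (ξ : κ → Lp ℂ 2 μ) (η : κ → Lp ℂ 2 ν),
      ‖∑ i, inner ℂ (η i) (S (ξ i))‖ₑ ≤ M * (∫⁻ z in ⋃ n, A n ×ˢ B n,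
        ‖∑ i, ξ i z.1 * conj (η i z.2)‖ₑ ^ (2 : ℝ) ∂μ.prod ν) ^ (1 / 2 : ℝ)) : S = 0 := by
  have hz : ∀ ξ η, inner ℂ η (S ξ) = 0 := by
    intro ξ η
    have hmeas : ∀ N, MeasurableSet (⋃ n < N, A n ×ˢ B n) := fun N =>
      MeasurableSet.biUnion (Set.to_countable _) fun n _ => (hA n).prod (hB n)
    have hb : ∀ N : ℕ, ‖inner ℂ η (S ξ)‖ₑ ≤ M * (∫⁻ z in ⋃ n, A n ×ˢ B n,
        ‖(⋃ n < N, A n ×ˢ B n)ᶜ.indicator (fun z => ξ z.1 * conj (η z.2)) z‖ₑ ^ (2 : ℝ)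
          ∂μ.prod ν) ^ (1 / 2 : ℝ) := by
      intro N
      obtain ⟨κ, _, ξ', η', hsum, hae⟩ := exists_elementary_tensors hA hB h ξ η N
      rw [← hsum]
      refine (hM κ ξ' η').trans_eq ?_
      congr 2
      refine lintegral_congr_ae ?_
      filter_upwards [ae_restrict_of_ae hae] with z hz
      rw [hz]
    have hprod : AEStronglyMeasurable (fun z : X × Y => ξ z.1 * conj (η z.2)) (μ.prod ν) :=
      (Lp.aestronglyMeasurable ξ).comp_fst.mul
        (RCLike.continuous_conj.comp_aestronglyMeasurable (Lp.aestronglyMeasurable η).comp_snd)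
    have hfin : ∫⁻ z in ⋃ n, A n ×ˢ B n, ‖ξ z.1 * conj (η z.2)‖ₑ ^ (2 : ℝ) ∂μ.prod ν ≠ ∞ := by
      refine ne_top_of_le_ne_top ?_ (setLIntegral_le_lintegral _ _)
      simp only [enorm_mul, RCLike.enorm_conj, ENNReal.mul_rpow_of_nonneg _ _ zero_le_two]
      rw [lintegral_prod_mul (f := fun x => ‖ξ x‖ₑ ^ (2 : ℝ)) (g := fun y => ‖η y‖ₑ ^ (2 : ℝ))
        ((Lp.aestronglyMeasurable ξ).enorm.pow_const _)
        ((Lp.aestronglyMeasurable η).enorm.pow_const _), lintegral_enorm_sq, lintegral_enorm_sq]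
      exact ENNReal.mul_ne_top (ENNReal.rpow_ne_top_of_nonneg zero_le_two enorm_ne_top)
        (ENNReal.rpow_ne_top_of_nonneg zero_le_two enorm_ne_top)
    have hlim : Filter.Tendsto (fun N : ℕ => ∫⁻ z in ⋃ n, A n ×ˢ B n,
        ‖(⋃ n < N, A n ×ˢ B n)ᶜ.indicator (fun z => ξ z.1 * conj (η z.2)) z‖ₑ ^ (2 : ℝ)
          ∂μ.prod ν) Filter.atTop (nhds (∫⁻ _ in ⋃ n, A n ×ˢ B n, 0 ∂μ.prod ν)) := by
      refine tendsto_lintegral_of_dominated_convergence'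
        (fun z => ‖ξ z.1 * conj (η z.2)‖ₑ ^ (2 : ℝ)) (fun N => ?_) (fun N => ?_) hfin ?_
      · exact ((hprod.indicator (hmeas N).compl).restrict.enorm).pow_const _
      · exact .of_forall fun z => ENNReal.rpow_le_rpow (enorm_indicator_le_enorm_self _ _)
          zero_le_two
      · refine (ae_restrict_iff' (MeasurableSet.iUnion fun n => (hA n).prod (hB n))).2
          (.of_forall fun z hz => ?_)
        obtain ⟨n, hn⟩ := Set.mem_iUnion.1 hz
        refine tendsto_const_nhds.congr' ?_
        filter_upwards [Filter.eventually_gt_atTop n] with N hN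
        have : z ∈ ⋃ n < N, A n ×ˢ B n := Set.mem_iUnion₂.2 ⟨n, hN, hn⟩
        rw [Set.indicator_of_notMem (Set.notMem_compl_iff.2 this)]
        simp
    rw [lintegral_zero] at hlim
    have hlim2 := ENNReal.Tendsto.const_mul (hlim.ennrpow_const (1 / 2)) (Or.inr hMtop)
    rw [ENNReal.zero_rpow_of_pos (by norm_num), mul_zero] at hlim2
    exact enorm_eq_zero.1 (le_antisymm (ge_of_tendsto' hlim2 hb) zero_le)
  ext1 ξ
  exact inner_self_eq_zero.1 (hz ξ (S ξ))

end Exhaustion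

/-! ### Averaging over a partition -/

section Averaging

open ComplexConjugate InnerProductSpace Metric

variable {X Y : Type*} [MeasurableSpace X] [MeasurableSpace Y] {μ : Measure X} {ν : Measure Y}

/-- The normalised indicator function of a set of finite positive measure. -/
noncomputable def unitIndicator (μ : Measure X) {D : Set X} (hD : MeasurableSet D) (hμ : μ D ≠ ∞) :
    Lp ℂ 2 μ :=
  ((‖indicatorConstLp (μ := μ) 2 hD hμ (1 : ℂ)‖⁻¹ : ℝ) : ℂ) • indicatorConstLp 2 hD hμ (1 : ℂ)

lemma unitIndicator_ae {D : Set X} (hD : MeasurableSet D) (hμ : μ D ≠ ∞) :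
    ∀ᵐ x ∂μ, x ∉ D → unitIndicator μ hD hμ x = 0 := by
  filter_upwards [Lp.coeFn_smul ((‖indicatorConstLp (μ := μ) 2 hD hμ (1 : ℂ)‖⁻¹ : ℝ) : ℂ)
    (indicatorConstLp 2 hD hμ (1 : ℂ)), indicatorConstLp_coeFn (p := 2) (hs := hD) (hμs := hμ)
      (c := (1 : ℂ))] with x h1 h2 hx
  rw [unitIndicator, h1, Pi.smul_apply, h2]
  simp [hx]

lemma norm_indicatorConstLp_ne_zero {D : Set X} (hD : MeasurableSet D) (hμ : μ D ≠ ∞)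
    (h0 : μ D ≠ 0) : ‖indicatorConstLp (μ := μ) 2 hD hμ (1 : ℂ)‖ ≠ 0 := by
  rw [norm_indicatorConstLp two_ne_zero ENNReal.ofNat_ne_top]
  have : 0 < μ.real D := ENNReal.toReal_pos h0 hμ
  rw [norm_one, one_mul]
  exact (Real.rpow_pos_of_pos this _).ne'

lemma norm_unitIndicator {D : Set X} (hD : MeasurableSet D) (hμ : μ D ≠ ∞) (h0 : μ D ≠ 0) :
    ‖unitIndicator μ hD hμ‖ = 1 := by
  rw [unitIndicator, norm_smul, Complex.norm_real, norm_inv, norm_norm]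
  exact inv_mul_cancel₀ (norm_indicatorConstLp_ne_zero hD hμ h0)

lemma orthonormal_unitIndicator {κ : Type*} {D : κ → Set X} (hD : ∀ j, MeasurableSet (D j))
    (hμ : ∀ j, μ (D j) ≠ ∞) (h0 : ∀ j, μ (D j) ≠ 0) (hdisj : Pairwise (Function.onFun Disjoint D)) :
    Orthonormal ℂ fun j => unitIndicator μ (hD j) (hμ j) := by
  refine ⟨fun j => norm_unitIndicator (hD j) (hμ j) (h0 j), fun i j hij => ?_⟩
  change inner ℂ _ _ = 0
  rw [L2.inner_def]
  refine integral_eq_zero_of_ae ?_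
  filter_upwards [unitIndicator_ae (hD i) (hμ i), unitIndicator_ae (hD j) (hμ j)] with x h1 h2
  by_cases hx : x ∈ D i
  · simp [h2 (Set.disjoint_left.1 (hdisj hij) hx)]
  · simp [h1 hx]

/-- The difference between a function and its averages over the pieces of a partition is at most
the oscillation of the function on the pieces. -/
lemma norm_sub_averaging_le {κ : Type*} [Fintype κ] {D : κ → Set X} (hD : ∀ j, MeasurableSet (D j))
    (hμ : ∀ j, μ (D j) ≠ ∞) (h0 : ∀ j, μ (D j) ≠ 0) (hdisj : Pairwise (Function.onFun Disjoint D))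
    {G : Set X} (hG : MeasurableSet G) (hμG : μ G ≠ ∞) (hDG : ∀ j, D j ⊆ G)
    (hcov : ∀ᵐ x ∂μ, x ∈ G → ∃ j, x ∈ D j) {u : X → ℂ} {ε : ℝ}
    (hu : ∀ j, ∀ x ∈ D j, ∀ y ∈ D j, ‖u x - u y‖ ≤ ε) {b : Lp ℂ 2 μ} (hb : b =ᵐ[μ] G.indicator u) :
    ‖b - (∑ j, rankOne ℂ (unitIndicator μ (hD j) (hμ j)) (unitIndicator μ (hD j) (hμ j))) b‖ ≤
      ε * ‖indicatorConstLp (μ := μ) 2 hG hμG (1 : ℂ)‖ := by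
  obtain ⟨U, _, hU, hP⟩ :=
    sum_rankOne_eq_starProjection (orthonormal_unitIndicator hD hμ h0 hdisj)
  rw [hP, Submodule.starProjection_minimal]
  have hne : ∀ j, (D j).Nonempty := fun j => nonempty_of_measure_ne_zero (h0 j)
  choose c hc using hne
  have hmem : ∀ j, indicatorConstLp (μ := μ) 2 (hD j) (hμ j) (1 : ℂ) ∈ U := by
    intro j
    refine (U.smul_mem_iff ?_).1 (hU j)
    have := norm_indicatorConstLp_ne_zero (hD j) (hμ j) (h0 j)
    exact_mod_cast inv_ne_zero this
  -- The projection is at least as good an approximation as the step function with the values of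
  -- `u` at the sample points `c j`.
  let v : U := ∑ j, u (c j) • ⟨_, hmem j⟩
  refine (ciInf_le ⟨0, by rintro _ ⟨x, rfl⟩; exact norm_nonneg _⟩ v).trans ?_
  have hv : (v : Lp ℂ 2 μ) = ∑ j, u (c j) • indicatorConstLp (μ := μ) 2 (hD j) (hμ j) (1 : ℂ) := by
    simp [v]
  have hvae : ∀ᵐ x ∂μ, (v : Lp ℂ 2 μ) x = ∑ j, u (c j) * (D j).indicator (fun _ => (1 : ℂ)) x := by
    rw [hv]
    have h1 : ∀ᵐ x ∂μ, ∀ j, (u (c j) • indicatorConstLp (μ := μ) 2 (hD j) (hμ j) (1 : ℂ)) x =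
        u (c j) * (D j).indicator (fun _ => (1 : ℂ)) x := by
      refine ae_all_iff.2 fun j => ?_
      filter_upwards [Lp.coeFn_smul (u (c j)) (indicatorConstLp (μ := μ) 2 (hD j) (hμ j) (1 : ℂ)),
        indicatorConstLp_coeFn (p := 2) (hs := hD j) (hμs := hμ j) (c := (1 : ℂ))] with x h2 h3
      rw [h2, Pi.smul_apply, h3, smul_eq_mul]
    filter_upwards [h1, Lp.coeFn_finsetSum Finset.univ fun j =>
      u (c j) • indicatorConstLp (μ := μ) 2 (hD j) (hμ j) (1 : ℂ)] with x h2 h3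
    rw [h3, Finset.sum_apply]
    exact Finset.sum_congr rfl fun j _ => h2 j
  refine Lp.norm_le_mul_norm_of_ae_le_mul ?_
  filter_upwards [hb, hvae, hcov, Lp.coeFn_sub b v,
    indicatorConstLp_coeFn (p := 2) (hs := hG) (hμs := hμG) (c := (1 : ℂ))] with x h1 h2 h3 h4 h5
  rw [h4, Pi.sub_apply, h1, h2, h5]
  by_cases hx : x ∈ G
  · obtain ⟨k, hk⟩ := h3 hx
    rw [Finset.sum_eq_single k]
    · simpa [hx, hk] using hu k x hk (c k) (hc k)
    · intro j _ hj
      simp [Set.disjoint_left.1 (hdisj hj.symm) hk]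
    · simp
  · have : ∀ j, x ∉ D j := fun j hj => hx (hDG j hj)
    simp [hx, this]

variable [MetricSpace X]

/-- Continuous functions are dense in `L²` of a set of finite measure. -/
lemma exists_continuous_norm_sub_le [BorelSpace X] {G : Set X} (hG : MeasurableSet G)
    (hμG : μ G ≠ ∞) (a : Lp ℂ 2 μ) {ε : ℝ} (hε : 0 < ε) :
    ∃ (u : X → ℂ) (b : Lp ℂ 2 μ), Continuous u ∧ b =ᵐ[μ] G.indicator u ∧
      ‖indicatorOp μ G hG a - b‖ ≤ ε := by
  have : IsFiniteMeasure (μ.restrict G) := ⟨by simpa using hμG.lt_top⟩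
  obtain ⟨u, hu, hmem⟩ := ((Lp.memLp a).restrict G).exists_boundedContinuous_eLpNorm_sub_le
    ENNReal.ofNat_ne_top (ε := ENNReal.ofReal ε) (by simpa using hε)
  have hmem' : MemLp (G.indicator u) 2 μ := (memLp_indicator_iff_restrict hG).2 hmem
  refine ⟨u, hmem'.toLp _, u.continuous, hmem'.coeFn_toLp, ?_⟩
  rw [Lp.norm_def]
  refine ENNReal.toReal_le_of_le_ofReal hε.le (le_trans (le_of_eq ?_) hu)
  rw [← eLpNorm_indicator_eq_eLpNorm_restrict hG]
  refine eLpNorm_congr_ae ?_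
  filter_upwards [Lp.coeFn_sub (indicatorOp μ G hG a) (hmem'.toLp _), indicatorOp_apply_ae hG a,
    hmem'.coeFn_toLp] with x h1 h2 h3
  rw [h1, Pi.sub_apply, h2, h3]
  by_cases hx : x ∈ G <;> simp [hx]

/-- The estimate for the restriction of an operator `T`, supported in the complement of the union
of the rectangles `A n × B n`, to the functions that are constant on the pieces of a finite
partition of a compact set. A piece `D j` contributes a rank one operator, which lives on the set
of all `(x, y)` such that `x ∈ D j` and such that the closure of `D j` meets the fibre over `y`. -/
lemma VInftyRep.Represents.enorm_sum_inner_Delta_averaging_le [SigmaFinite μ] [SigmaFinite ν]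
    {R : VInftyRep μ ν} {F : X → Y → ℂ} (hR : R.Represents F) {A : ℕ → Set X} {B : ℕ → Set Y}
    (hA : ∀ n, MeasurableSet (A n)) (hB : ∀ n, MeasurableSet (B n))
    {T : Lp ℂ 2 μ →L[ℂ] Lp ℂ 2 ν} (hT : ∀ n, VanishesOnRect T (A n) (B n)) {ρ : ℝ} (hρ : 0 < ρ)
    {C : ℝ≥0} (hF : ∀ᵐ z ∂μ.prod ν,
      ‖F z.1 z.2‖ₑ ≤ C * infEDist z.1 {x' | (x', z.2) ∈ (⋃ n, A n ×ˢ B n)ᶜ} ^ ρ)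
    {G : Set X} (hG : IsCompact G) (hGA : ∀ n, IsClosed (G \ A n))
    {κ : Type*} [Fintype κ] {D : κ → Set X} (hD : ∀ j, MeasurableSet (D j))
    (hμ : ∀ j, μ (D j) ≠ ∞) (h0 : ∀ j, μ (D j) ≠ 0) (hdisj : Pairwise (Function.onFun Disjoint D))
    (hDG : ∀ j, D j ⊆ G) {κ' : Type*} [Fintype κ'] (ξ : κ' → Lp ℂ 2 μ) (η : κ' → Lp ℂ 2 ν) :
    ‖∑ i, inner ℂ (η i) (R.Delta (T ∘L ∑ j, rankOne ℂ (unitIndicator μ (hD j) (hμ j))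
        (unitIndicator μ (hD j) (hμ j))) (ξ i))‖ₑ ≤
      C * ‖T‖ₑ * (∑ j, ediam (D j) ^ (2 * ρ)) ^ (1 / 2 : ℝ) * (∫⁻ z in ⋃ n, A n ×ˢ B n,
        ‖∑ i, ξ i z.1 * conj (η i z.2)‖ₑ ^ (2 : ℝ) ∂μ.prod ν) ^ (1 / 2 : ℝ) := by
  set e : κ → Lp ℂ 2 μ := fun j => unitIndicator μ (hD j) (hμ j) with he
  let W : κ → Set (X × Y) := fun j => (D j ×ˢ Set.univ) ∩ ⋃ n, A n ×ˢ B n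
  have hUm : MeasurableSet (⋃ n, A n ×ˢ B n) := MeasurableSet.iUnion fun n => (hA n).prod (hB n)
  have hW : ∀ j, MeasurableSet (W j) := fun j => ((hD j).prod MeasurableSet.univ).inter hUm
  have hWdisj : Pairwise (Function.onFun Disjoint W) := fun i j hij =>
    Set.disjoint_left.2 fun z hz hz' => Set.disjoint_left.1 (hdisj hij) hz.1.1 hz'.1.1
  set I : Set (X × Y) → ℝ≥0∞ := fun V =>
    ∫⁻ z in V, ‖∑ i, ξ i z.1 * conj (η i z.2)‖ₑ ^ (2 : ℝ) ∂μ.prod ν with hI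
  have hpiece : ∀ j, ‖∑ i, inner ℂ (η i) (R.Delta (rankOne ℂ (T (e j)) (e j)) (ξ i))‖ₑ ≤
      C * ediam (D j) ^ ρ * (‖e j‖ₑ * ‖T (e j)‖ₑ) * I (W j) ^ (1 / 2 : ℝ) := by
    intro j
    refine hR.enorm_sum_inner_Delta_rankOne_le (hW j) ?_ ξ η
    -- The closure of `D j`, unlike `D j` itself, is compact, and it has the same diameter.
    have hclG : closure (D j) ⊆ G := closure_minimal (hDG j) hG.isClosed
    have hcl : IsCompact (closure (D j)) := hG.of_isClosed_subset isClosed_closure hclG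
    have hclA : ∀ n, IsClosed (closure (D j) \ A n) := by
      intro n
      have : closure (D j) \ A n = closure (D j) ∩ (G \ A n) := by
        ext x
        exact ⟨fun hx => ⟨hx.1, hclG hx.1, hx.2⟩, fun hx => ⟨hx.1, hx.2.2⟩⟩
      rw [this]
      exact isClosed_closure.inter (hGA n)
    have hτ : ∀ᵐ y ∂ν, y ∈ coverSet A B (closure (D j)) → T (e j) y = 0 := by
      refine VanishesOnRect.coverSet hA hT _ _ ?_
      filter_upwards [unitIndicator_ae (hD j) (hμ j)] with x hx hxD
      exact hx fun h => hxD (subset_closure h)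
    filter_upwards [hF, Measure.quasiMeasurePreserving_fst.ae (unitIndicator_ae (hD j) (hμ j)),
      Measure.quasiMeasurePreserving_snd.ae hτ] with z h1 h2 h3 hF0 he0 hτ0
    have hzD : z.1 ∈ D j := by
      by_contra h
      exact he0 (h2 h)
    obtain ⟨x', hx', hx'n⟩ := exists_notMem_of_notMem_coverSet hcl hclA fun h => hτ0 (h3 h)
    refine ⟨⟨⟨hzD, Set.mem_univ _⟩, ?_⟩, h1.trans ?_⟩
    -- On the complement of the rectangles the distance is `0`, and `0 ^ ρ = 0` since `ρ > 0`.
    · by_contra hz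
      have hz0 : infEDist z.1 {x' | (x', z.2) ∈ (⋃ n, A n ×ˢ B n)ᶜ} = 0 :=
        infEDist_zero_of_mem (s := {x' | (x', z.2) ∈ (⋃ n, A n ×ˢ B n)ᶜ}) hz
      rw [hz0, ENNReal.zero_rpow_of_pos hρ, mul_zero] at h1
      exact hF0 (enorm_eq_zero.1 (le_antisymm h1 zero_le))
    · gcongr
      refine (infEDist_le_edist_of_mem (y := x') ?_).trans ?_
      · simpa using hx'n
      · rw [← ediam_closure]
        exact edist_le_ediam_of_mem (subset_closure hzD) hx'
  have hsplit : ∑ i, inner ℂ (η i) (R.Delta (T ∘L ∑ j, rankOne ℂ (e j) (e j)) (ξ i)) =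
      ∑ j, ∑ i, inner ℂ (η i) (R.Delta (rankOne ℂ (T (e j)) (e j)) (ξ i)) := by
    rw [Finset.sum_comm]
    refine Finset.sum_congr rfl fun i _ => ?_
    rw [ContinuousLinearMap.comp_finsetSum, map_sum, sum_apply, inner_sum]
    simp only [comp_rankOne]
  have hIsum : ∑ j, I (W j) ≤ I (⋃ n, A n ×ˢ B n) := by
    rw [← tsum_fintype (L := .unconditional κ) (fun j => I (W j)), hI, ← lintegral_iUnion hW hWdisj]
    exact lintegral_mono_set (Set.iUnion_subset fun j => Set.inter_subset_right)
  rw [hsplit]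
  calc _ ≤ ∑ j, ‖∑ i, inner ℂ (η i) (R.Delta (rankOne ℂ (T (e j)) (e j)) (ξ i))‖ₑ :=
        enorm_sum_le _ _
    _ ≤ ∑ j, C * ‖T‖ₑ * (ediam (D j) ^ ρ * I (W j) ^ (1 / 2 : ℝ)) := by
        refine Finset.sum_le_sum fun j _ => (hpiece j).trans ?_
        have he1 : ‖e j‖ₑ = 1 := by
          rw [← ofReal_norm, he, norm_unitIndicator (hD j) (hμ j) (h0 j), ENNReal.ofReal_one]
        have hTe : ‖T (e j)‖ₑ ≤ ‖T‖ₑ := by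
          refine (T.le_opENorm (e j)).trans_eq ?_
          rw [he1, mul_one]
        calc _ = C * ‖T (e j)‖ₑ * (ediam (D j) ^ ρ * I (W j) ^ (1 / 2 : ℝ)) := by
              rw [he1]; ring
          _ ≤ _ := by gcongr
    _ = C * ‖T‖ₑ * ∑ j, ediam (D j) ^ ρ * I (W j) ^ (1 / 2 : ℝ) := by rw [Finset.mul_sum]
    _ ≤ C * ‖T‖ₑ * ((∑ j, (ediam (D j) ^ ρ) ^ (2 : ℝ)) ^ (1 / 2 : ℝ) *
          (∑ j, (I (W j) ^ (1 / 2 : ℝ)) ^ (2 : ℝ)) ^ (1 / 2 : ℝ)) := by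
        gcongr
        exact ENNReal.inner_le_Lp_mul_Lq _ _ _ Real.HolderConjugate.two_two
    _ ≤ _ := by
        simp only [← ENNReal.rpow_mul, mul_comm ρ 2, show (1 / 2 : ℝ) * 2 = 1 by norm_num,
          ENNReal.rpow_one]
        rw [← mul_assoc]
        gcongr

end Averaging

/-! ### Operators supported in `E` are annihilated -/

section Synthesis

open ComplexConjugate InnerProductSpace Metric

variable {X Y : Type*} [MetricSpace X] [MeasurableSpace X] [BorelSpace X] [MeasurableSpace Y]
  {μ : Measure X} {ν : Measure Y}

/-- On a compact set `G` of finite `2ρ`-dimensional Hausdorff measure, averaging over a partition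
into pieces of small diameter gives a contraction `P` that is close to the identity on continuous
functions and for which the kernel of `Δ_F(TP)` is bounded in `L²`, uniformly in the
partition. -/
lemma VInftyRep.Represents.exists_averaging [SigmaFinite μ] [SigmaFinite ν]
    {R : VInftyRep μ ν} {F : X → Y → ℂ} (hR : R.Represents F) {A : ℕ → Set X} {B : ℕ → Set Y}
    (hA : ∀ n, MeasurableSet (A n)) (hB : ∀ n, MeasurableSet (B n))
    {T : Lp ℂ 2 μ →L[ℂ] Lp ℂ 2 ν} (hT : ∀ n, VanishesOnRect T (A n) (B n)) {ρ : ℝ} (hρ : 0 < ρ)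
    {C : ℝ≥0} (hF : ∀ᵐ z ∂μ.prod ν,
      ‖F z.1 z.2‖ₑ ≤ C * infEDist z.1 {x' | (x', z.2) ∈ (⋃ n, A n ×ˢ B n)ᶜ} ^ ρ)
    {G : Set X} (hG : IsCompact G) (hGA : ∀ n, IsClosed (G \ A n)) (hμG : μ G ≠ ∞)
    (hGH : Measure.hausdorffMeasure (2 * ρ) G ≠ ∞) {r : ℝ≥0∞} (hr : r ≠ 0) :
    ∃ P : Lp ℂ 2 μ →L[ℂ] Lp ℂ 2 μ, (∀ a, ‖P a‖ ≤ ‖a‖) ∧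
      (∀ a, P (indicatorOp μ G hG.measurableSet a) = P a) ∧
      (∀ (u : X → ℂ) (b : Lp ℂ 2 μ) (ε : ℝ),
        (∀ x ∈ G, ∀ y ∈ G, edist x y ≤ r → ‖u x - u y‖ ≤ ε) → b =ᵐ[μ] G.indicator u →
          ‖b - P b‖ ≤ ε * ‖indicatorConstLp (μ := μ) 2 hG.measurableSet hμG (1 : ℂ)‖) ∧
      ∀ (κ : Type) [Fintype κ] (ξ : κ → Lp ℂ 2 μ) (η : κ → Lp ℂ 2 ν),
        ‖∑ i, inner ℂ (η i) (R.Delta (T ∘L P) (ξ i))‖ₑ ≤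
          C * ‖T‖ₑ * (Measure.hausdorffMeasure (2 * ρ) G + 1) ^ (1 / 2 : ℝ) *
            (∫⁻ z in ⋃ n, A n ×ˢ B n,
              ‖∑ i, ξ i z.1 * conj (η i z.2)‖ₑ ^ (2 : ℝ) ∂μ.prod ν) ^ (1 / 2 : ℝ) := by
  obtain ⟨N, D, hD, hdisj, hDG, hdiam, hsum⟩ :=
    exists_finite_partition (by positivity : 0 < 2 * ρ) hG hGH hr
  have hsub : ∀ j, D j ⊆ G := fun j => hDG ▸ Set.subset_iUnion D j
  have hfin : ∀ j, μ (D j) ≠ ∞ := fun j => measure_ne_top_of_subset (hsub j) hμG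
  -- Pieces of measure zero are discarded, as they have no normalised indicator function.
  let J := {j : Fin N // μ (D j) ≠ 0}
  have hdisjJ : Pairwise (Function.onFun Disjoint fun j : J => D j) := fun i j hij =>
    hdisj fun h => hij (Subtype.ext h)
  have hcov : ∀ᵐ x ∂μ, x ∈ G → ∃ j : J, x ∈ D j := by
    have h1 : ∀ᵐ x ∂μ, ∀ j, μ (D j) = 0 → x ∉ D j := by
      refine ae_all_iff.2 fun j => ?_
      by_cases h : μ (D j) = 0
      · filter_upwards [measure_eq_zero_iff_ae_notMem.1 h] with x hx _ using hx
      · exact .of_forall fun x h' => absurd h' h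
    filter_upwards [h1] with x hx hxG
    rw [← hDG] at hxG
    obtain ⟨j, hj⟩ := Set.mem_iUnion.1 hxG
    exact ⟨⟨j, fun h => hx j h hj⟩, hj⟩
  have hP := sum_rankOne_eq_starProjection (orthonormal_unitIndicator (fun j : J => hD j)
    (fun j => hfin j) (fun j => j.2) hdisjJ)
  refine ⟨∑ j : J, rankOne ℂ (unitIndicator μ (hD j) (hfin j)) (unitIndicator μ (hD j) (hfin j)),
    fun a => ?_, fun a => ?_, fun u b ε hu hb => ?_, fun κ _ ξ η => ?_⟩
  · obtain ⟨U, _, -, hU⟩ := hP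
    rw [hU]
    exact U.norm_starProjection_apply_le a
  · rw [sum_apply, sum_apply]
    refine Finset.sum_congr rfl fun j _ => ?_
    rw [rankOne_apply, rankOne_apply]
    congr 1
    rw [L2.inner_def, L2.inner_def]
    refine integral_congr_ae ?_
    filter_upwards [unitIndicator_ae (hD j) (hfin j), indicatorOp_apply_ae hG.measurableSet a]
      with x h1 h2
    rw [h2]
    by_cases hx : x ∈ D j
    · rw [Set.indicator_of_mem (hsub j hx)]
    · rw [h1 hx, inner_zero_left, inner_zero_left]
  · refine norm_sub_averaging_le (fun j : J => hD j) (fun j => hfin j) (fun j => j.2) hdisjJ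
      hG.measurableSet hμG (fun j => hsub j) hcov (fun j x hx y hy => ?_) hb
    exact hu x (hsub j hx) y (hsub j hy) ((edist_le_ediam_of_mem hx hy).trans (hdiam j))
  · refine (hR.enorm_sum_inner_Delta_averaging_le hA hB hT hρ hF hG hGA (fun j : J => hD j)
      (fun j => hfin j) (fun j => j.2) hdisjJ (fun j => hsub j) ξ η).trans ?_
    gcongr
    refine le_trans ?_ hsum
    classical
    rw [← Finset.sum_subtype (Finset.univ.filter fun j => μ (D j) ≠ 0) (by simp)
      (fun j => ediam (D j) ^ (2 * ρ))]
    exact Finset.sum_le_sum_of_subset (Finset.filter_subset _ _)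

/-- Refining the partitions yields `Δ_F(T P(G)) = 0`: its kernel is square integrable, it
vanishes on the rectangles `A n × B n` because `T` does, and it vanishes off their union because
`F` does. -/
lemma VInftyRep.Represents.Delta_comp_indicatorOp_eq_zero [SigmaFinite μ] [SigmaFinite ν]
    {R : VInftyRep μ ν} {F : X → Y → ℂ} (hR : R.Represents F) {A : ℕ → Set X} {B : ℕ → Set Y}
    (hA : ∀ n, MeasurableSet (A n)) (hB : ∀ n, MeasurableSet (B n))
    {T : Lp ℂ 2 μ →L[ℂ] Lp ℂ 2 ν} (hT : ∀ n, VanishesOnRect T (A n) (B n)) {ρ : ℝ} (hρ : 0 < ρ)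
    {C : ℝ≥0} (hF : ∀ᵐ z ∂μ.prod ν,
      ‖F z.1 z.2‖ₑ ≤ C * infEDist z.1 {x' | (x', z.2) ∈ (⋃ n, A n ×ˢ B n)ᶜ} ^ ρ)
    {G : Set X} (hG : IsCompact G) (hGA : ∀ n, IsClosed (G \ A n)) (hμG : μ G ≠ ∞)
    (hGH : Measure.hausdorffMeasure (2 * ρ) G ≠ ∞) :
    R.Delta (T ∘L indicatorOp μ G hG.measurableSet) = 0 := by
  have hr : ∀ n : ℕ, ((n : ℝ≥0∞) + 1)⁻¹ ≠ 0 := fun n => by simp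
  choose P hPn hPG hPu hPb using fun n =>
    hR.exists_averaging hA hB hT hρ hF hG hGA hμG hGH (hr n)
  set L : ℝ := ‖indicatorConstLp (μ := μ) 2 hG.measurableSet hμG (1 : ℂ)‖ with hL
  have hlim : ∀ a, Filter.Tendsto (fun n => P n a) Filter.atTop
      (nhds (indicatorOp μ G hG.measurableSet a)) := by
    intro a
    rw [Metric.tendsto_atTop]
    intro ε hε
    obtain ⟨u, b, hu, hb, hab⟩ :=
      exists_continuous_norm_sub_le hG.measurableSet hμG a (show 0 < ε / 4 by positivity)
    have hδ : 0 < ε / (4 * (L + 1)) := by positivity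
    have huc := hG.uniformContinuousOn_of_continuous hu.continuousOn
    obtain ⟨δ, hδ0, hδu⟩ := Metric.uniformContinuousOn_iff_le.1 huc _ hδ
    obtain ⟨n₀, hn₀⟩ := ENNReal.exists_inv_nat_lt (ENNReal.ofReal_pos.2 hδ0).ne'
    refine ⟨n₀, fun n hn => ?_⟩
    -- `P n a = P n a'` and `P n` is a contraction, so that `a'` may be replaced by `b`.
    set a' := indicatorOp μ G hG.measurableSet a
    have h1 : ‖b - P n b‖ ≤ ε / (4 * (L + 1)) * L := by
      refine hPu n u b _ (fun x hx y hy hxy => ?_) hb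
      rw [← dist_eq_norm]
      refine hδu x hx y hy ?_
      rw [edist_dist] at hxy
      refine (ENNReal.ofReal_le_ofReal_iff hδ0.le).1 (hxy.trans (le_trans ?_ hn₀.le))
      gcongr
      exact (Nat.cast_le.2 hn).trans le_self_add
    have h2 : ε / (4 * (L + 1)) * L ≤ ε / 4 := by
      rw [div_mul_eq_mul_div, div_le_div_iff₀ (by positivity) (by positivity)]
      nlinarith [norm_nonneg (indicatorConstLp (μ := μ) 2 hG.measurableSet hμG (1 : ℂ))]
    rw [dist_eq_norm, ← hPG n a]
    calc ‖P n a' - a'‖ = ‖P n (a' - b) - (b - P n b) - (a' - b)‖ := by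
          rw [map_sub]; congr 1; abel
      _ ≤ ‖P n (a' - b)‖ + ‖b - P n b‖ + ‖a' - b‖ :=
          (norm_sub_le _ _).trans (by gcongr; exact norm_sub_le _ _)
      _ ≤ ε / 4 + ε / 4 + ε / 4 := by
          gcongr
          · exact (hPn n _).trans hab
          · exact h1.trans h2
      _ < ε := by linarith
  have hM : (C : ℝ≥0∞) * ‖T‖ₑ * (Measure.hausdorffMeasure (2 * ρ) G + 1) ^ (1 / 2 : ℝ) ≠ ∞ :=
    ENNReal.mul_ne_top (ENNReal.mul_ne_top ENNReal.coe_ne_top enorm_ne_top)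
      (ENNReal.rpow_ne_top_of_nonneg (by norm_num) (by finiteness))
  refine eq_zero_of_vanishesOnRect_of_bound hA hB
    (fun n => ((hT n).comp_indicatorOp hG.measurableSet).Delta (hA n) (hB n)) hM
    fun κ _ ξ η => ?_
  have htend : Filter.Tendsto (fun n => ∑ i, inner ℂ (η i) (R.Delta (T ∘L P n) (ξ i)))
      Filter.atTop (nhds (∑ i, inner ℂ (η i)
        (R.Delta (T ∘L indicatorOp μ G hG.measurableSet) (ξ i)))) :=
    tendsto_finsetSum _ fun i _ =>
      tendsto_const_nhds.inner (R.tendsto_Delta_comp T hPn hlim (ξ i))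
  exact le_of_tendsto' ((continuous_enorm.tendsto _).comp htend) fun n => hPb n κ ξ η

/-- If `|F(x, y)| ≤ C d(x, E^y)^ρ` and the `2ρ`-dimensional Hausdorff measure is `σ`-finite, then
`Δ_F` annihilates the operators supported in `E`. -/
theorem VInftyRep.Represents.Mmax_subset_ker_Delta [SigmaFinite μ] [SigmaFinite ν]
    [μ.InnerRegularCompactLTTop] {R : VInftyRep μ ν} {F : X → Y → ℂ} (hR : R.Represents F)
    {E : Set (X × Y)} (hE : PseudoClosed μ ν E) {ρ : ℝ} (hρ : 0 < ρ)
    (hH : SigmaFinite (Measure.hausdorffMeasure (2 * ρ) : Measure X)) {C : ℝ≥0}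
    (hF : MarginallyAE μ ν fun x y => ‖F x y‖ₑ ≤ C * infEDist x {x' | (x', y) ∈ E} ^ ρ) :
    Mmax μ ν E ⊆ (LinearMap.ker R.Delta : Set (Lp ℂ 2 μ →L[ℂ] Lp ℂ 2 ν)) := by
  intro T hTE
  obtain ⟨A, B, hA, hB, hsub, hnull⟩ := hE.exists_subset
  have hT' : SupportedIn T (⋃ n, A n ×ˢ B n)ᶜ := SupportedIn.of_diff_marginallyNull hTE hnull
  have hT : ∀ n, VanishesOnRect T (A n) (B n) := by
    intro n
    refine hT'.vanishesOnRect (hA n) (hB n) ?_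
    rw [← Set.disjoint_iff_inter_eq_empty, Set.disjoint_compl_right_iff_subset]
    exact Set.subset_iUnion (fun n => A n ×ˢ B n) n
  have hF' : ∀ᵐ z ∂μ.prod ν,
      ‖F z.1 z.2‖ₑ ≤ C * infEDist z.1 {x' | (x', z.2) ∈ (⋃ n, A n ×ˢ B n)ᶜ} ^ ρ := by
    filter_upwards [hF.ae] with z hz
    refine hz.trans ?_
    gcongr
  obtain ⟨K, hKU, hK, hKA, hμK, hlim⟩ := exists_isCompact_seq μ hA
    (U := spanningSets (Measure.hausdorffMeasure (2 * ρ)))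
    (measurableSet_spanningSets _) (fun x =>
      (Filter.eventually_ge_atTop (spanningSetsIndex _ x)).mono fun i hi =>
        mem_spanningSets_of_index_le _ x hi)
  have hzero := fun i => hR.Delta_comp_indicatorOp_eq_zero hA hB hT hρ hF' (hK i) (hKA i) (hμK i)
    (measure_ne_top_of_subset (hKU i) (measure_spanningSets_lt_top _ i).ne)
  change R.Delta T = 0
  ext1 ξ
  refine tendsto_nhds_unique (((R.Delta T).continuous.tendsto _).comp
    (tendsto_indicatorOp (fun i => (hK i).measurableSet) hlim ξ)) ?_
  refine tendsto_const_nhds.congr fun i => ?_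
  have := congrArg (fun S => S ξ) (hzero i)
  rw [R.Delta_comp_indicatorOp] at this
  exact this.symm

end Synthesis

/-! ### Annihilated operators are supported in the null set -/

section Converse

variable {X Y : Type*} [MeasurableSpace X] [MeasurableSpace Y] {μ : Measure X} {ν : Measure Y}

lemma norm_mulOp_sub_smul_le {f : Lp ℂ ∞ μ} {ξ : Lp ℂ 2 μ} {A : Set X} {a : ℂ} {α : ℝ}
    (hf : ∀ᵐ x ∂μ, x ∈ A → ‖f x - a‖ ≤ α) (hξ : ∀ᵐ x ∂μ, x ∉ A → ξ x = 0) :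
    ‖mulOp μ f ξ - a • ξ‖ ≤ α * ‖ξ‖ := by
  refine Lp.norm_le_mul_norm_of_ae_le_mul ?_
  filter_upwards [hf, hξ, mulOp_apply_ae f ξ, Lp.coeFn_smul a ξ,
    Lp.coeFn_sub (mulOp μ f ξ) (a • ξ)] with x h1 h2 h3 h4 h5
  rw [h5, Pi.sub_apply, h3, h4, Pi.smul_apply, smul_eq_mul, ← sub_mul, norm_mul]
  by_cases hx : x ∈ A
  · exact mul_le_mul_of_nonneg_right (h1 hx) (norm_nonneg _)
  · simp [h2 hx]

/-- If on the rectangle `A × B` all the functions `f m` and `g m` are close to constants, so close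
that `F` is a small perturbation of a nonzero constant there, then an operator `T` with
`Δ_F(T) = 0` vanishes on `A × B`. -/
lemma VInftyRep.vanishesOnRect_of_almost_constant (R : VInftyRep μ ν)
    {T : Lp ℂ 2 μ →L[ℂ] Lp ℂ 2 ν} (hT : R.Delta T = 0) {A : Set X} {B : Set Y}
    (hA : MeasurableSet A) (hB : MeasurableSet B) {a b : ℕ → ℂ} {α β : ℕ → ℝ}
    (hα : ∀ m, 0 ≤ α m) (hβ : ∀ m, 0 ≤ β m) (ha : ∀ m, ‖a m‖ ≤ ‖R.f m‖) (hb : ∀ m, ‖b m‖ ≤ ‖R.g m‖)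
    (hfA : ∀ m, ∀ᵐ x ∂μ, x ∈ A → ‖R.f m x - a m‖ ≤ α m)
    (hgB : ∀ m, ∀ᵐ y ∂ν, y ∈ B → ‖R.g m y - b m‖ ≤ β m)
    (hsum : Summable fun m => α m * ‖R.g m‖ + ‖R.f m‖ * β m)
    (hlt : ∑' m, (α m * ‖R.g m‖ + ‖R.f m‖ * β m) < ‖∑' m, a m * b m‖) :
    VanishesOnRect T A B := by
  rw [vanishesOnRect_iff hA hB]
  -- With `S = Q(B) T P(A)` and `c = ∑ a m * b m`, the operator `c S = c S - Δ_F(S)` has norm at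
  -- most the sum in `hlt` times `‖S‖`, which forces `S = 0`.
  set S := indicatorOp ν B hB ∘L T ∘L indicatorOp μ A hA with hS
  have hS0 : R.Delta S = 0 := by
    rw [hS, R.Delta_indicatorOp_comp, R.Delta_comp_indicatorOp, hT]
    simp
  have hab : Summable fun m => a m * b m := by
    refine Summable.of_norm_bounded R.summable_norm_mul fun m => ?_
    rw [norm_mul]
    exact mul_le_mul (ha m) (hb m) (norm_nonneg _) (norm_nonneg _)
  have hPP : ∀ ξ, S (indicatorOp μ A hA ξ) = S ξ := by
    intro ξ
    simp only [hS, ContinuousLinearMap.comp_apply]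
    rw [indicatorOp_apply_eq_self hA (indicatorOp_apply_eq_zero_of_notMem hA ξ)]
  set s := ∑' m, (α m * ‖R.g m‖ + ‖R.f m‖ * β m)
  have key : ∀ ξ, ‖∑' m, a m * b m‖ * ‖S ξ‖ ≤ s * (‖S‖ * ‖ξ‖) := by
    intro ξ
    set ξ' := indicatorOp μ A hA ξ
    have hξ' : ‖ξ'‖ ≤ ‖ξ‖ := norm_indicatorOp_apply_le hA ξ
    have h1 : HasSum (fun m => mulOp ν (R.g m) (S (mulOp μ (R.f m) ξ')) - (a m * b m) • S ξ)
        (0 - (∑' m, a m * b m) • S ξ) := by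
      refine HasSum.sub ?_ (hab.hasSum.smul_const _)
      simpa [hS0] using R.hasSum_Delta_apply S ξ'
    have h2 : ∀ m, ‖mulOp ν (R.g m) (S (mulOp μ (R.f m) ξ')) - (a m * b m) • S ξ‖ ≤
        (α m * ‖R.g m‖ + ‖R.f m‖ * β m) * (‖S‖ * ‖ξ‖) := by
      intro m
      have e1 : ‖mulOp μ (R.f m) ξ' - a m • ξ'‖ ≤ α m * ‖ξ'‖ :=
        norm_mulOp_sub_smul_le (hfA m) (indicatorOp_apply_eq_zero_of_notMem hA ξ)
      have e2 : ‖mulOp ν (R.g m) (S ξ) - b m • S ξ‖ ≤ β m * ‖S ξ‖ :=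
        norm_mulOp_sub_smul_le (hgB m) (indicatorOp_apply_eq_zero_of_notMem hB _)
      have hdec : mulOp ν (R.g m) (S (mulOp μ (R.f m) ξ')) - (a m * b m) • S ξ =
          mulOp ν (R.g m) (S (mulOp μ (R.f m) ξ' - a m • ξ')) +
            a m • (mulOp ν (R.g m) (S ξ) - b m • S ξ) := by
        rw [map_sub, map_sub, map_smul, map_smul, hPP ξ, smul_sub, mul_smul]
        abel
      rw [hdec]
      calc _ ≤ ‖mulOp ν (R.g m) (S (mulOp μ (R.f m) ξ' - a m • ξ'))‖ +
            ‖a m • (mulOp ν (R.g m) (S ξ) - b m • S ξ)‖ := norm_add_le _ _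
        _ ≤ ‖R.g m‖ * (‖S‖ * (α m * ‖ξ‖)) + ‖R.f m‖ * (β m * (‖S‖ * ‖ξ‖)) := by
          gcongr
          · refine ((mulOp ν (R.g m)).le_of_opNorm_le (norm_mulOp_le _ _) _).trans ?_
            gcongr
            refine (S.le_opNorm _).trans ?_
            gcongr
            exact e1.trans (mul_le_mul_of_nonneg_left hξ' (hα m))
          · rw [norm_smul]
            exact mul_le_mul (ha m) (e2.trans (mul_le_mul_of_nonneg_left (S.le_opNorm ξ) (hβ m)))
              (norm_nonneg _) (norm_nonneg _)
        _ = _ := by ring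
    have h3 := tsum_of_norm_bounded (hsum.hasSum.mul_right (‖S‖ * ‖ξ‖)) h2
    rwa [h1.tsum_eq, zero_sub, norm_neg, norm_smul] at h3
  have hs0 : 0 ≤ s := tsum_nonneg fun m =>
    add_nonneg (mul_nonneg (hα m) (norm_nonneg _)) (mul_nonneg (norm_nonneg _) (hβ m))
  have hc : 0 < ‖∑' m, a m * b m‖ := hs0.trans_lt hlt
  have hs : ‖S‖ ≤ s / ‖∑' m, a m * b m‖ * ‖S‖ := by
    refine S.opNorm_le_bound (by positivity) fun ξ => ?_
    rw [div_mul_eq_mul_div, div_mul_eq_mul_div, le_div_iff₀ hc, mul_comm, mul_assoc]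
    exact key ξ
  rw [div_mul_eq_mul_div, le_div_iff₀ hc] at hs
  rw [← norm_eq_zero]
  nlinarith [norm_nonneg S]

/-- The weights on the left are at most `2 * u m` and, for `m < N`, at most `1 / (N + 1)`. -/
lemma tendsto_tsum_of_eventually_le_inv {u v : ℕ → ℝ} (hu : ∀ m, 0 ≤ u m) (hv : ∀ m, 0 ≤ v m)
    (h : Summable fun m => u m * v m) :
    Filter.Tendsto (fun N : ℕ => ∑' m, min (2 * u m) (if m < N then 1 / ((N : ℝ) + 1) else 2 * u m)
      * v m) Filter.atTop (nhds 0) := by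
  have h0 : ∀ (N m : ℕ), 0 ≤ min (2 * u m) (if m < N then 1 / ((N : ℝ) + 1) else 2 * u m) := by
    intro N m
    have := hu m
    refine le_min (by positivity) ?_
    split_ifs <;> positivity
  rw [← tsum_zero (α := ℝ) (β := ℕ)]
  refine tendsto_tsum_of_dominated_convergence (bound := fun m => 2 * (u m * v m))
    (h.mul_left 2) (fun m => ?_) (.of_forall fun N m => ?_)
  · have h1 : Filter.Tendsto (fun N : ℕ => 1 / ((N : ℝ) + 1) * v m) Filter.atTop (nhds 0) := by
      simpa using (tendsto_one_div_add_atTop_nhds_zero_nat (𝕜 := ℝ)).mul_const (v m)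
    refine squeeze_zero' (.of_forall fun N => mul_nonneg (h0 N m) (hv m)) ?_ h1
    filter_upwards [Filter.eventually_gt_atTop m] with N hN
    rw [if_pos hN]
    exact mul_le_mul_of_nonneg_right (min_le_right _ _) (hv m)
  · rw [Real.norm_of_nonneg (mul_nonneg (h0 N m) (hv m)), ← mul_assoc]
    exact mul_le_mul_of_nonneg_right (min_le_left _ _) (hv m)

/-- Up to marginally null sets, the set where `F ≠ 0` is a countable union of measurable
rectangles on which every operator `T` with `Δ_F(T) = 0` vanishes. In particular it is
pseudo-open. -/
lemma VInftyRep.exists_rectangles (R : VInftyRep μ ν) :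
    ∃ (A : ℕ → Set X) (B : ℕ → Set Y), (∀ n, MeasurableSet (A n)) ∧ (∀ n, MeasurableSet (B n)) ∧
      (MarginallyAE μ ν fun x y =>
        ∑' m, R.f m x * R.g m y ≠ 0 ↔ (x, y) ∈ ⋃ n, A n ×ˢ B n) ∧
      ∀ T, R.Delta T = 0 → ∀ n, VanishesOnRect T (A n) (B n) := by
  classical
  -- `γ w N m` bounds the distance between the `m`-th terms of two sequences which are dominated by
  -- `w` and whose first `N` terms differ by less than `1 / (N + 1)`.
  let γ : (ℕ → ℝ) → ℕ → ℕ → ℝ := fun u N m =>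
    min (2 * u m) (if m < N then 1 / ((N : ℝ) + 1) else 2 * u m)
  let u : ℕ → ℝ := fun m => ‖R.f m‖
  let v : ℕ → ℝ := fun m => ‖R.g m‖
  have hγ0 : ∀ w : ℕ → ℝ, (∀ m, 0 ≤ w m) → ∀ N m, 0 ≤ γ w N m := by
    intro w hw N m
    have := hw m
    refine le_min (by positivity) ?_
    split_ifs <;> positivity
  have hγ2 : ∀ w : ℕ → ℝ, ∀ N m, γ w N m ≤ 2 * w m := fun w N m => min_le_left _ _
  have hu : ∀ m, 0 ≤ u m := fun m => norm_nonneg _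
  have hv : ∀ m, 0 ≤ v m := fun m => norm_nonneg _
  have hs1 : ∀ N, Summable fun m => γ u N m * v m := fun N =>
    Summable.of_nonneg_of_le (fun m => mul_nonneg (hγ0 u hu N m) (hv m))
      (fun m => (mul_le_mul_of_nonneg_right (hγ2 u N m) (hv m)).trans_eq (mul_assoc _ _ _))
      (R.summable_norm_mul.mul_left 2)
  have hs2 : ∀ N, Summable fun m => u m * γ v N m := fun N =>
    Summable.of_nonneg_of_le (fun m => mul_nonneg (hu m) (hγ0 v hv N m))
      (fun m => (mul_le_mul_of_nonneg_left (hγ2 v N m) (hu m)).trans_eq (by ring))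
      (R.summable_norm_mul.mul_left 2)
  have hlim : Filter.Tendsto (fun N => ∑' m, (γ u N m * v m + u m * γ v N m)) Filter.atTop
      (nhds 0) := by
    have h1 := tendsto_tsum_of_eventually_le_inv hu hv R.summable_norm_mul
    have h2 := tendsto_tsum_of_eventually_le_inv hv hu
      (R.summable_norm_mul.congr fun m => mul_comm _ _)
    have h3 := h1.add h2
    rw [add_zero] at h3
    refine h3.congr fun N => ?_
    rw [(hs1 N).tsum_add (hs2 N)]
    congr 1
    exact tsum_congr fun m => mul_comm _ _
  let W : Set ((ℕ → ℂ) × (ℕ → ℂ)) := {p | (∀ m, ‖p.1 m‖ ≤ u m) ∧ (∀ m, ‖p.2 m‖ ≤ v m) ∧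
    ∑' m, p.1 m * p.2 m ≠ 0}
  have hN : ∀ p : (ℕ → ℂ) × (ℕ → ℂ), ∃ N, p ∈ W →
      ∑' m, (γ u N m * v m + u m * γ v N m) < ‖∑' m, p.1 m * p.2 m‖ := by
    intro p
    by_cases hp : p ∈ W
    · obtain ⟨N, hN⟩ := (hlim.eventually_lt_const (norm_pos_iff.2 hp.2.2)).exists
      exact ⟨N, fun _ => hN⟩
    · exact ⟨0, fun h => absurd h hp⟩
  choose N hN using hN
  let O : (ℕ → ℂ) → ℕ → Set (ℕ → ℂ) := fun a N => {c | ∀ m < N, ‖c m - a m‖ < 1 / ((N : ℝ) + 1)}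
  have hO : ∀ a N, IsOpen (O a N) := by
    intro a N
    have : O a N = ⋂ m ∈ Finset.range N, {c | ‖c m - a m‖ < 1 / ((N : ℝ) + 1)} := by
      ext c
      simp [O]
    rw [this]
    exact isOpen_biInter_finset fun m _ => isOpen_lt (by fun_prop) continuous_const
  have haO : ∀ a N, a ∈ O a N := fun a N m _ => by
    simp only [sub_self, norm_zero]
    positivity
  -- `ℕ → ℂ` is second countable, so countably many of these product neighbourhoods cover `W`.
  obtain ⟨t, htW, htc, ht⟩ := TopologicalSpace.countable_cover_nhdsWithin (s := W)
    (f := fun p => O p.1 (N p) ×ˢ O p.2 (N p)) fun p _ =>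
      mem_nhdsWithin_of_mem_nhds (((hO _ _).prod (hO _ _)).mem_nhds ⟨haO _ _, haO _ _⟩)
  have : Countable t := htc.to_subtype
  -- `Option t` rather than `t`, which is empty when `F = 0`.
  obtain ⟨φ, hφ⟩ := exists_surjective_nat (Option t)
  let ff : X → ℕ → ℂ := fun x m => R.f m x
  let gg : Y → ℕ → ℂ := fun y m => R.g m y
  have hff : Measurable ff := measurable_pi_iff.2 fun m => (Lp.stronglyMeasurable _).measurable
  have hgg : Measurable gg := measurable_pi_iff.2 fun m => (Lp.stronglyMeasurable _).measurable
  let A : Option t → Set X := fun o => o.elim ∅ fun p => ff ⁻¹' O p.1.1 (N p)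
  let B : Option t → Set Y := fun o => o.elim ∅ fun p => gg ⁻¹' O p.1.2 (N p)
  have hAm : ∀ o, MeasurableSet (A o) := by
    rintro (_ | p)
    exacts [MeasurableSet.empty, hff (hO _ _).measurableSet]
  have hBm : ∀ o, MeasurableSet (B o) := by
    rintro (_ | p)
    exacts [MeasurableSet.empty, hgg (hO _ _).measurableSet]
  have hclose : ∀ (w : ℕ → ℝ) (a c : ℕ → ℂ) (M : ℕ), (∀ m, ‖a m‖ ≤ w m) → (∀ m, ‖c m‖ ≤ w m) →
      c ∈ O a M → ∀ m, ‖c m - a m‖ ≤ γ w M m := by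
    intro w a c M ha hc hcO m
    have h2 : ‖c m - a m‖ ≤ 2 * w m := (norm_sub_le _ _).trans (by linarith [ha m, hc m])
    refine le_min h2 ?_
    split_ifs with h
    exacts [(hcO m h).le, h2]
  have hfx := ae_all_iff.2 fun m => ae_norm_le_norm_Lp_top (R.f m)
  have hgy := ae_all_iff.2 fun m => ae_norm_le_norm_Lp_top (R.g m)
  have hvan : ∀ T, R.Delta T = 0 → ∀ o, VanishesOnRect T (A o) (B o) := by
    rintro T hT (_ | p)
    · exact VanishesOnRect.of_measure_eq_zero_left T _ (measure_empty (μ := μ))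
    · have hpW := htW p.2
      refine R.vanishesOnRect_of_almost_constant hT (hAm (some p)) (hBm (some p))
        (a := p.1.1) (b := p.1.2) (α := γ u (N p)) (β := γ v (N p)) (hγ0 u hu _) (hγ0 v hv _)
        hpW.1 hpW.2.1 (fun m => ?_) (fun m => ?_) ((hs1 _).add (hs2 _)) (hN p hpW)
      · filter_upwards [hfx] with x hx hxA
        exact hclose u _ _ _ hpW.1 hx hxA m
      · filter_upwards [hgy] with y hy hyB
        exact hclose v _ _ _ hpW.2.1 hy hyB m
  refine ⟨fun n => A (φ n), fun n => B (φ n), fun n => hAm _, fun n => hBm _, ?_, ?_⟩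
  · refine ⟨{x | ¬ ∀ m, ‖R.f m x‖ ≤ ‖R.f m‖}, {y | ¬ ∀ m, ‖R.g m y‖ ≤ ‖R.g m‖}, hfx, hgy, ?_⟩
    rintro ⟨x, y⟩ hxy
    by_contra hnot
    simp only [Set.mem_union, Set.mem_prod, Set.mem_univ, and_true, true_and, not_or,
      Set.mem_ofPred_eq, not_not] at hnot
    obtain ⟨hx, hy⟩ := hnot
    refine hxy ⟨fun hne => ?_, fun hmem => ?_⟩
    · obtain ⟨p, hp, hpO⟩ := Set.mem_iUnion₂.1 (ht (show (ff x, gg y) ∈ W from ⟨hx, hy, hne⟩))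
      obtain ⟨n, hn⟩ := hφ (some ⟨p, hp⟩)
      refine Set.mem_iUnion.2 ⟨n, ?_⟩
      simp only [hn]
      exact hpO
    · obtain ⟨n, hn⟩ := Set.mem_iUnion.1 hmem
      rcases hφn : φ n with _ | p
      · simp [hφn, A] at hn
      simp only [hφn] at hn
      have hpW := htW p.2
      have hlt := hN p hpW
      intro hzero
      have hca := hclose u _ _ _ hpW.1 hx hn.1
      have hcb := hclose v _ _ _ hpW.2.1 hy hn.2
      have hsx : Summable fun m => R.f m x * R.g m y :=
        Summable.of_norm_bounded R.summable_norm_mul fun m => by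
          rw [norm_mul]
          exact mul_le_mul (hx m) (hy m) (norm_nonneg _) (norm_nonneg _)
      have hsp : Summable fun m => p.1.1 m * p.1.2 m :=
        Summable.of_norm_bounded R.summable_norm_mul fun m => by
          rw [norm_mul]
          exact mul_le_mul (hpW.1 m) (hpW.2.1 m) (norm_nonneg _) (norm_nonneg _)
      have hdiff := hsx.hasSum.sub hsp.hasSum
      rw [hzero, zero_sub] at hdiff
      have hle := tsum_of_norm_bounded ((hs1 (N p)).add (hs2 (N p))).hasSum (f := fun m =>
        R.f m x * R.g m y - p.1.1 m * p.1.2 m) fun m => by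
          have hdec : R.f m x * R.g m y - p.1.1 m * p.1.2 m =
            (R.f m x - p.1.1 m) * R.g m y + p.1.1 m * (R.g m y - p.1.2 m) := by ring
          rw [hdec]
          refine (norm_add_le _ _).trans ?_
          rw [norm_mul, norm_mul]
          exact add_le_add
            (mul_le_mul (hca m) (hy m) (norm_nonneg _) (hγ0 u hu _ _))
            (mul_le_mul (hpW.1 m) (hcb m) (norm_nonneg _) (hu m))
      rw [hdiff.tsum_eq, norm_neg] at hle
      exact absurd hlt (not_lt.2 hle)
  · exact fun T hT n => hvan T hT (φ n)

/-- An operator `T` with `Δ_F(T) = 0` is supported in the null set of `F`. -/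
theorem VInftyRep.Represents.ker_Delta_subset_Mmax [TopologicalSpace X] [T2Space X] [BorelSpace X]
    [SigmaFinite μ] [μ.InnerRegularCompactLTTop] {R : VInftyRep μ ν} {F : X → Y → ℂ}
    (hR : R.Represents F) {E : Set (X × Y)} (hE : IsNullSet μ ν F E) :
    (LinearMap.ker R.Delta : Set (Lp ℂ 2 μ →L[ℂ] Lp ℂ 2 ν)) ⊆ Mmax μ ν E := by
  intro T hT U V hU hV hUV
  obtain ⟨A, B, hA, hB, hAB, hvan⟩ := R.exists_rectangles
  have hFAB : MarginallyAE μ ν fun x y => F x y ≠ 0 ↔ (x, y) ∈ ⋃ n, A n ×ˢ B n := by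
    refine (hR.union hAB).mono fun z hz => ?_
    by_contra hnot
    simp only [Set.mem_union, Set.mem_ofPred_eq, not_or, not_not] at hnot
    refine hz ?_
    change F z.1 z.2 ≠ 0 ↔ (z.1, z.2) ∈ _
    rw [← hnot.1.tsum_eq]
    exact hnot.2
  have hnull : MarginallyNull μ ν ({z | F z.1 z.2 = 0} \ E) := by
    refine hE.2.2 _ ⟨A, B, hA, hB, hFAB.mono ?_⟩ ⟨∅, ∅, measure_empty, measure_empty, ?_⟩
    · rintro z (⟨h1, h2⟩ | ⟨h1, h2⟩) h
      · exact h2 (h.1 h1)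
      · exact h2 (h.2 h1)
    · rintro z hz
      exact (hz fun h => h).elim
  obtain ⟨X₁, Y₁, hX₁, hY₁, hsub⟩ := (hFAB.union hnull).union hUV
  set S := indicatorOp ν V hV ∘L T ∘L indicatorOp μ U hU with hS
  have hTS : R.Delta S = 0 := by
    rw [hS, R.Delta_indicatorOp_comp, R.Delta_comp_indicatorOp, show R.Delta T = 0 from hT]
    simp
  have hS0 : ∀ ξ : Lp ℂ 2 μ, ∀ᵐ y ∂ν, y ∈ Vᶜ → S ξ y = 0 := fun ξ =>
    indicatorOp_apply_eq_zero_of_notMem hV _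
  -- Off the rectangles `A n × B n`, the point lies outside `U × V` or in an exceptional null set.
  let A' : ℕ ⊕ Bool → Set X := Sum.elim A fun b => if b then Uᶜ ∪ toMeasurable μ X₁ else Set.univ
  let B' : ℕ ⊕ Bool → Set Y := Sum.elim B fun b => if b then Set.univ else Vᶜ ∪ Y₁
  refine eq_zero_of_vanishesOnRect_of_cover (ι := ℕ ⊕ Bool) (A := A') (B := B') ?_ ?_ ?_
  · rintro (n | _ | _)
    exacts [hA n, MeasurableSet.univ, hU.compl.union (measurableSet_toMeasurable _ _)]
  · intro x y
    by_cases hx : x ∈ Uᶜ ∪ toMeasurable μ X₁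
    · exact ⟨Sum.inr true, hx, Set.mem_univ y⟩
    by_cases hy : y ∈ Vᶜ ∪ Y₁
    · exact ⟨Sum.inr false, Set.mem_univ x, hy⟩
    simp only [Set.mem_union, Set.mem_compl_iff, not_or, not_not] at hx hy
    have hnot := mt (@hsub (x, y)) (by
      rintro (h | h)
      exacts [hx.2 (subset_toMeasurable _ _ h.1), hy.2 h.2])
    simp only [Set.mem_union, Set.mem_ofPred_eq, not_or, not_not] at hnot
    have hxyE : (x, y) ∉ E := fun h => hnot.2 ⟨⟨hx.1, hy.1⟩, h⟩
    have hFne : F x y ≠ 0 := fun h => hnot.1.2 ⟨h, hxyE⟩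
    obtain ⟨n, hn⟩ := Set.mem_iUnion.1 (hnot.1.1.1 hFne)
    exact ⟨Sum.inl n, hn.1, hn.2⟩
  · rintro (n | _ | _)
    · exact hvan S hTS n
    · intro ξ _
      filter_upwards [hS0 ξ, measure_eq_zero_iff_ae_notMem.1 hY₁] with y h1 h2 hy
      exact hy.elim h1 fun h => absurd h h2
    · refine VanishesOnRect.union_left hU.compl ?_
        (VanishesOnRect.of_measure_eq_zero_left S _ (by rw [measure_toMeasurable, hX₁]))
      intro ξ hξ
      have h0 : indicatorOp μ U hU ξ = 0 := by
        rw [indicatorOp_apply_eq_zero_iff]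
        filter_upwards [hξ] with x hx hxU
        exact hx fun h => h hxU
      have h1 : S ξ = 0 := by simp [hS, h0]
      rw [h1]
      filter_upwards [Lp.coeFn_zero ℂ 2 ν] with y hy _
      simpa using hy

end Converse

end OpSynth

theorem mainTheorem1 {X Y : Type*}
    [MetricSpace X] [CompactSpace X] [MeasurableSpace X] [BorelSpace X]
    [TopologicalSpace Y] [T2Space Y] [CompactSpace Y] [MeasurableSpace Y] [BorelSpace Y]
    (μ : MeasureTheory.Measure X) [MeasureTheory.SigmaFinite μ] [μ.InnerRegularCompactLTTop]
    (ν : MeasureTheory.Measure Y) [MeasureTheory.SigmaFinite ν] [ν.InnerRegularCompactLTTop]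
    (w : NNReal) (hw : dimH (Set.univ : Set X) = (w : ENNReal))
    (ρ : ℝ) (hρ_pos : 0 < ρ) (hρ : (w : ℝ) / 2 ≤ ρ)
    (hρ_eq : ρ = (w : ℝ) / 2 →
      MeasureTheory.SigmaFinite (MeasureTheory.Measure.hausdorffMeasure (w : ℝ) :
        MeasureTheory.Measure X))
    (E : Set (X × Y)) (hE : OpSynth.PseudoClosed μ ν E)
    (F : X → Y → ℂ) (R : OpSynth.VInftyRep μ ν) (hR : R.Represents F)
    (C : NNReal) (hC : 0 < C)
    (hF : OpSynth.MarginallyAE μ ν fun x y =>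
      ENNReal.ofReal ‖F x y‖ ≤ (C : ENNReal) * Metric.infEDist x {x' : X | (x', y) ∈ E} ^ ρ) :
    (OpSynth.Mmax μ ν E ⊆
        (LinearMap.ker R.Delta :
          Set (MeasureTheory.Lp ℂ 2 μ →L[ℂ] MeasureTheory.Lp ℂ 2 ν))) ∧
      (OpSynth.IsNullSet μ ν F E → OpSynth.IsOperatorSynthetic F R) := by
  have hH : SigmaFinite (Measure.hausdorffMeasure (2 * ρ) : Measure X) := by
    -- Above the Hausdorff dimension the Hausdorff measure is zero.
    rcases hρ.eq_or_lt with h | h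
    · have h2 : 2 * ρ = w := by rw [← h]; ring
      rw [h2]
      exact hρ_eq h.symm
    · have hlt : dimH (Set.univ : Set X) < ((2 * ρ).toNNReal : ℝ≥0∞) := by
        rw [hw, ENNReal.coe_lt_coe, ← NNReal.coe_lt_coe, Real.coe_toNNReal _ (by positivity)]
        linarith
      have h0 := hausdorffMeasure_of_dimH_lt hlt
      rw [Real.coe_toNNReal _ (by positivity), Measure.measure_univ_eq_zero] at h0
      rw [h0]
      infer_instance
  have hsub := hR.Mmax_subset_ker_Delta hE hρ_pos hH
    (C := C) (by simpa only [ofReal_norm] using hF)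
  exact ⟨hsub, fun hN => ⟨E, hN, (hR.ker_Delta_subset_Mmax hN).antisymm hsub⟩⟩
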